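/- Let $\Psi\colon[0,1]\to\mathbb{R}$ be twice continuously differentiable with $\Psi(1)=\Psi'(1)=1$, $\Psi''(1)>0$ and $\Psi(x)>\Psi(1)+\Psi'(1)(x-1)=x$ for all $0\le x<1$. Set $F(\eta)=\Psi(\eta^2)-\eta^2$ for $\eta\in[-1,1]$ and let $\beta>0$. Let $$\mathcal{M}=\{u\colon\mathbb{R}\to[-1,1]\;:\;u\text{ is odd and nondecreasing}\}\subset L^\infty(\mathbb{R}).$$ Let $Z=\mathbb{Z}$ (on-site setting) or $Z=\tfrac12+\mathbb{Z}$ (inter-site setting). For $\varepsilon>0$ let $\mathcal{M}_\varepsilon$ be the set of all $u\in\mathcal{M}$ such that $u(\varepsilon j+\varepsilon\xi)=u(\varepsilon j)$ for all $j\in Z$ and $|\xi|<\tfrac12$, and put $$\mathcal{E}_\varepsilon(u)=\int_{\mathbb{R}}F(u(\xi))\,d\xi+\beta\int_{\mathbb{R}}\Big(\frac{u(\xi+\varepsilon)-u(\xi)}{\varepsilon}\Big)^2d\xi\in[0,\infty],\qquad u\in\mathcal{M}.$$ (For $u\in\mathcal{M}_\varepsilon$ this is $\varepsilon\sum_{j\in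 Z}F(u(\varepsilon j))+\varepsilon\,\frac{\beta}{\varepsilon^2}\sum_{j\in Z}(u(\varepsilon j+\varepsilon)-u(\varepsilon j))^2$, i.e. up to the factor $\varepsilon$ the lattice energy with coupling $\beta/\varepsilon^2$.) Then the following hold. 1. There is exactly one $u\in\mathcal{M}$ that is twice differentiable and satisfies $2\beta u''=F'(u)$ on $\mathbb{R}$ and $\lim_{\xi\to\pm\infty}u(\xi)=\pm1$. It is the same for both choices of $Z$. 2. For each of the two choices of $Z$ and every $\varepsilon>0$, $\mathcal{E}_\varepsilon$ attains its minimum on $\mathcal{M}_\varepsilon$, and every minimizer $v$ satisfies $$\int_{\mathbb{R}}F'(v(\xi))\varphi(\xi)\,d\xi=2\beta\int_{\mathbb{R}}v(\xi)\,\frac{\varphi(\xi+\varepsilon)+\varphi(\xi-\varepsilon)-2\varphi(\xi)}{\varepsilon^2}\,d\xi\qquad\text{for all }\varphi\in C_0^\infty(\mathbb{R}).$$ Moreover, there is a constant $C$, independent of $\varepsilon$, such that $\mathcal{E}_\varepsilon(v)\le C$ for every $0<\varepsilon\le1$ and every minimizer $v$ of $\mathcal{E}_\varepsilon$ on $\mathcal{M}_\varepsilon$.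 3. For each of the two choices of $Z$ and every choice of minimizers $u_\varepsilon$ of $\mathcal{E}_\varepsilon$ on $\mathcal{M}_\varepsilon$, $\varepsilon>0$, one has $u_\varepsilon\to u$ in $L^\infty_{\rm loc}(\mathbb{R})$ as $\varepsilon\to0$. -/

import Mathlib

open Set Filter MeasureTheory
open scoped Topology ENNReal ContDiff

namespace DNLS

/-- The standing (normalized) assumptions on the potential `Ψ : [0, 1] → ℝ`: it is `C²` on `[0, 1]`
(one-sided at the endpoints), `Ψ(1) = Ψ'(1) = 1`, `Ψ''(1) > 0`, and `Ψ` lies strictly above its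
tangent line at `1` on `[0, 1)`. Values of `Ψ` outside `[0, 1]` are never used. -/
structure IsPotential (Ψ : ℝ → ℝ) : Prop where
  contDiffOn : ContDiffOn ℝ 2 Ψ (Icc 0 1)
  value_one : Ψ 1 = 1
  deriv_one : derivWithin Ψ (Icc 0 1) 1 = 1
  deriv_two_pos : 0 < iteratedDerivWithin 2 Ψ (Icc 0 1) 1
  above_tangent : ∀ x : ℝ, 0 ≤ x → x < 1 →
    Ψ 1 + derivWithin Ψ (Icc 0 1) 1 * (x - 1) < Ψ x

/-- The normalized on-site energy density `F(η) = Ψ(η²) - η²`, used for `η ∈ [-1, 1]`. -/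
noncomputable def F (Ψ : ℝ → ℝ) (η : ℝ) : ℝ := Ψ (η ^ 2) - η ^ 2

/-- The derivative `F'` on `[-1, 1]` (one-sided at `±1`). -/
noncomputable def F' (Ψ : ℝ → ℝ) (η : ℝ) : ℝ := derivWithin (F Ψ) (Icc (-1) 1) η

/-- `F ≥ 0` on `[-1, 1]`, so that the energies below, defined with values in `[0, ∞]`, truncate
nothing for profiles with values in `[-1, 1]`. -/
theorem F_nonneg {Ψ : ℝ → ℝ} (h : IsPotential Ψ) {η : ℝ} (hη : η ∈ Icc (-1 : ℝ) 1) :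
    0 ≤ F Ψ η := by
  have h1 : η ^ 2 ≤ 1 := by nlinarith [hη.1, hη.2]
  unfold F
  rcases h1.lt_or_eq with h2 | h2
  · have h3 := h.above_tangent (η ^ 2) (sq_nonneg η) h2
    rw [h.value_one, h.deriv_one] at h3
    linarith
  · rw [h2, h.value_one, sub_self]

/-- Index set `Z = ℤ` of the on-site setting, as a set of reals. -/
def onSite : Set ℝ := Set.range fun k : ℤ => (k : ℝ)

/-- Index set `Z = 1/2 + ℤ` of the inter-site setting. -/
def interSite : Set ℝ := Set.range fun k : ℤ => 1 / 2 + (k : ℝ)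

/-- The set `𝓜` of odd, increasing (i.e. nondecreasing) profiles `u : ℝ → [-1, 1]`. Membership in
`L^∞(ℝ)` is automatic, see `memLp_top_of_mem_M`. -/
def M : Set (ℝ → ℝ) :=
  {u | ∀ ξ₁ ξ₂ : ℝ, ξ₁ ≤ ξ₂ → -1 ≤ u ξ₁ ∧ u ξ₁ ≤ u ξ₂ ∧ u ξ₂ = -u (-ξ₂) ∧ u ξ₂ ≤ 1}

theorem memLp_top_of_mem_M {u : ℝ → ℝ} (hu : u ∈ M) : MemLp u ∞ volume := by
  have hm : Monotone u := fun a b hab => (hu a b hab).2.1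
  refine memLp_top_of_bound hm.measurable.aestronglyMeasurable 1 (Eventually.of_forall fun x => ?_)
  have h := hu x x le_rfl
  exact abs_le.2 ⟨h.1, h.2.2.2⟩

/-- The profiles of `𝓜` that are constant on each cell `(ε (j - 1/2), ε (j + 1/2))`, `j ∈ Z`. -/
def Mdisc (Z : Set ℝ) (ε : ℝ) : Set (ℝ → ℝ) :=
  {u | u ∈ M ∧ ∀ j ∈ Z, ∀ ξ ∈ Ioo (-(1 / 2) : ℝ) (1 / 2), u (ε * j) = u (ε * j + ε * ξ)}

/-- The energy `𝓔_ε(u) = ∫ F(u(ξ)) dξ + β ∫ ((u(ξ + ε) - u(ξ)) / ε)² dξ ∈ [0, ∞]`. -/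
noncomputable def energy (Ψ : ℝ → ℝ) (β ε : ℝ) (u : ℝ → ℝ) : ℝ≥0∞ :=
  (∫⁻ ξ, ENNReal.ofReal (F Ψ (u ξ))) +
    ENNReal.ofReal β * ∫⁻ ξ, ENNReal.ofReal (((u (ξ + ε) - u ξ) / ε) ^ 2)

/-- `u` minimizes `𝓔_ε` on the piecewise constant profiles. -/
def IsMinimizer (Ψ : ℝ → ℝ) (β : ℝ) (Z : Set ℝ) (ε : ℝ) (u : ℝ → ℝ) : Prop :=
  u ∈ Mdisc Z ε ∧ ∀ v ∈ Mdisc Z ε, energy Ψ β ε u ≤ energy Ψ β ε v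

/-- The weak form of the rescaled discrete standing wave equation
`F'(u(ξ)) = 2 β (u(ξ + ε) + u(ξ - ε) - 2 u(ξ)) / ε²`. -/
def IsWeakDiscreteSolution (Ψ : ℝ → ℝ) (β ε : ℝ) (u : ℝ → ℝ) : Prop :=
  ∀ φ : ℝ → ℝ, ContDiff ℝ ∞ φ → HasCompactSupport φ →
    ∫ ξ, F' Ψ (u ξ) * φ ξ =
      2 * β * ∫ ξ, u ξ * ((φ (ξ + ε) + φ (ξ - ε) - 2 * φ ξ) / ε ^ 2)

/-- `u ∈ 𝓜` is a (classical, twice differentiable) solution of `2 β u'' = F'(u)` on `ℝ` with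
`u(±∞) = ±1`. -/
def IsHeteroclinic (Ψ : ℝ → ℝ) (β : ℝ) (u : ℝ → ℝ) : Prop :=
  u ∈ M ∧ Differentiable ℝ u ∧ Differentiable ℝ (deriv u) ∧
    (∀ ξ, 2 * β * deriv (deriv u) ξ = F' Ψ (u ξ)) ∧
    Tendsto u atTop (𝓝 1) ∧ Tendsto u atBot (𝓝 (-1))

/-- Convergence `u_ε → u` in `L^∞_loc(ℝ)` as `ε ↓ 0`. -/
def TendstoLinftyLoc (uε : ℝ → ℝ → ℝ) (u : ℝ → ℝ) : Prop :=
  ∀ K : Set ℝ, IsCompact K →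
    Tendsto (fun ε => eLpNorm (fun ξ => uε ε ξ - u ξ) ∞ (volume.restrict K)) (𝓝[>] 0) (𝓝 0)

end DNLS

namespace DNLS

/-! Heteroclinic profile: multiplying `2βu'' = F'(u)` by `u'` shows that `β u'² - F(u)` is constant.
Boundedness of `u` and `u(+∞) = 1` force the constant to be zero, so `u' = √(F(u)/β)`
(`hasDerivAt_of_isHeteroclinic`). Since `Ψ''(1) > 0`, `F` vanishes quadratically at `±1`, which
makes this right-hand side Lipschitz (`exists_lipschitz_sqrt`, `exists_lipschitz_speed`). Existence
and uniqueness then reduce to the first order Cauchy problem with `u(0) = 0`.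

Minimizers: up to null sets a cellwise constant profile is a monotone odd sequence, and its energy
is `ε` times a lattice energy with coupling `β/ε²` (`energy_eq`). Such sequences form a compact set
for pointwise convergence, on which the energy is lower semicontinuous. The constraint of
monotonicity is not active at a minimizer: variations at the two ends of a plateau would give
contradictory information on `F'` (`lt_succ_of_minimizer`). Hence the discrete equation holds at
every site (`euler_lagrange`).

Convergence: comparison with the clamped identity bounds the energy, so `∑ (a_{k+1} - a_k)² = O(ε)`
(`tsum_sq_diff_le`). The discrete analogue of `β u'² - F(u)` changes from site to site only by
Taylor remainders of this size and tends to zero at infinity, so it is `O(ε)` uniformly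
(`abs_first_integral_le`). Thus a minimizer solves the explicit Euler scheme for `u' = √(F(u)/β)` up
to a small error, and a discrete Gronwall estimate compares it with `u` (`euler_scheme_error`). -/

theorem sq_mem_Icc {η : ℝ} (hη : η ∈ Icc (-1 : ℝ) 1) : η ^ 2 ∈ Icc (0 : ℝ) 1 :=
  ⟨sq_nonneg η, by nlinarith [hη.1, hη.2]⟩

theorem neg_mem_Icc_one {η : ℝ} (hη : η ∈ Icc (-1 : ℝ) 1) : -η ∈ Icc (-1 : ℝ) 1 :=
  ⟨by linarith [hη.2], by linarith [hη.1]⟩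

theorem uniqueDiffOn_Icc_one : UniqueDiffOn ℝ (Icc (-1 : ℝ) 1) :=
  uniqueDiffOn_Icc (by norm_num)

theorem F_neg (Ψ : ℝ → ℝ) (η : ℝ) : F Ψ (-η) = F Ψ η := by
  simp [F]

/-! ### Regularity and degeneracy of the potential -/

namespace IsPotential

variable {Ψ : ℝ → ℝ} (h : IsPotential Ψ)
include h

theorem hasDerivWithinAt {s : ℝ} (hs : s ∈ Icc (0 : ℝ) 1) :
    HasDerivWithinAt Ψ (derivWithin Ψ (Icc 0 1) s) (Icc 0 1) s :=
  (h.contDiffOn.differentiableOn (by norm_num) s hs).hasDerivWithinAt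

theorem F_one : F Ψ 1 = 0 := by simp [F, h.value_one]

theorem F_neg_one : F Ψ (-1) = 0 := by simp [F, h.value_one]

theorem sub_id_pos {s : ℝ} (h0 : 0 ≤ s) (h1 : s < 1) : 0 < Ψ s - s := by
  have := h.above_tangent s h0 h1
  rw [h.value_one, h.deriv_one] at this
  linarith

theorem sub_id_nonneg {s : ℝ} (hs : s ∈ Icc (0 : ℝ) 1) : 0 ≤ Ψ s - s := by
  rcases hs.2.lt_or_eq with h1 | h1
  · exact (h.sub_id_pos hs.1 h1).le
  · simp [h1, h.value_one]

theorem F_pos {η : ℝ} (h0 : -1 < η) (h1 : η < 1) : 0 < F Ψ η :=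
  h.sub_id_pos (sq_nonneg η) (by nlinarith)

theorem contDiffOn_F : ContDiffOn ℝ 2 (F Ψ) (Icc (-1) 1) := by
  have hsq : ContDiffOn ℝ 2 (fun η : ℝ => η ^ 2) (Icc (-1) 1) := by fun_prop
  exact (h.contDiffOn.comp hsq fun η hη => sq_mem_Icc hη).sub hsq

theorem continuousOn_F : ContinuousOn (F Ψ) (Icc (-1) 1) := h.contDiffOn_F.continuousOn

theorem hasDerivWithinAt_F {η : ℝ} (hη : η ∈ Icc (-1 : ℝ) 1) :
    HasDerivWithinAt (F Ψ) (F' Ψ η) (Icc (-1) 1) η :=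
  (h.contDiffOn_F.differentiableOn (by norm_num) η hη).hasDerivWithinAt

theorem F'_eq {η : ℝ} (hη : η ∈ Icc (-1 : ℝ) 1) :
    F' Ψ η = 2 * η * (derivWithin Ψ (Icc 0 1) (η ^ 2) - 1) := by
  have h1 : HasDerivWithinAt (fun η : ℝ => η ^ 2) (2 * η) (Icc (-1) 1) η := by
    simpa using (hasDerivAt_pow 2 η).hasDerivWithinAt
  have h2 : HasDerivWithinAt (F Ψ) (derivWithin Ψ (Icc 0 1) (η ^ 2) * (2 * η) - 2 * η)
      (Icc (-1) 1) η :=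
    (HasDerivWithinAt.comp (h := fun η : ℝ => η ^ 2) η (h.hasDerivWithinAt (sq_mem_Icc hη)) h1
      fun x hx => sq_mem_Icc hx).sub h1
  have h3 := h2.derivWithin (uniqueDiffOn_Icc_one η hη)
  rw [F', h3]; ring

theorem F'_zero : F' Ψ 0 = 0 := by
  rw [h.F'_eq (by norm_num)]; ring

theorem F'_one : F' Ψ 1 = 0 := by
  rw [h.F'_eq (by norm_num)]; simp [h.deriv_one]

theorem F'_neg {η : ℝ} (hη : η ∈ Icc (-1 : ℝ) 1) : F' Ψ (-η) = -F' Ψ η := by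
  rw [h.F'_eq hη, h.F'_eq (neg_mem_Icc_one hη), neg_sq]; ring

theorem exists_lipschitz_F' :
    ∃ L : ℝ, 0 ≤ L ∧ ∀ x ∈ Icc (-1 : ℝ) 1, ∀ y ∈ Icc (-1 : ℝ) 1,
      |F' Ψ x - F' Ψ y| ≤ L * |x - y| := by
  have h1 : ContDiffOn ℝ 1 (F' Ψ) (Icc (-1) 1) :=
    h.contDiffOn_F.derivWithin uniqueDiffOn_Icc_one (by norm_num)
  obtain ⟨L, hL⟩ := h1.exists_lipschitzOnWith (by norm_num) (convex_Icc _ _) isCompact_Icc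
  exact ⟨L, L.2, fun x hx y hy => hL.dist_le_mul x hx y hy⟩

theorem exists_lipschitz_F :
    ∃ L : ℝ, 0 ≤ L ∧ ∀ x ∈ Icc (-1 : ℝ) 1, ∀ y ∈ Icc (-1 : ℝ) 1,
      |F Ψ x - F Ψ y| ≤ L * |x - y| := by
  obtain ⟨L, hL⟩ := h.contDiffOn_F.exists_lipschitzOnWith (by norm_num) (convex_Icc _ _)
    isCompact_Icc
  exact ⟨L, L.2, fun x hx y hy => hL.dist_le_mul x hx y hy⟩

theorem exists_bound_F : ∃ B : ℝ, 0 ≤ B ∧ ∀ x ∈ Icc (-1 : ℝ) 1, F Ψ x ≤ B := by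
  obtain ⟨L, hL0, hL⟩ := h.exists_lipschitz_F
  refine ⟨L * 2, by positivity, fun x hx => ?_⟩
  have h1 := (le_abs_self _).trans (hL x hx 1 (by norm_num))
  rw [h.F_one, sub_zero] at h1
  refine h1.trans (mul_le_mul_of_nonneg_left ?_ hL0)
  rw [abs_le]; constructor <;> linarith [hx.1, hx.2]

/-- First order Taylor expansion of `F` with quadratic remainder. -/
theorem exists_taylor_F :
    ∃ L : ℝ, 0 ≤ L ∧ ∀ x ∈ Icc (-1 : ℝ) 1, ∀ y ∈ Icc (-1 : ℝ) 1,
      |F Ψ y - F Ψ x - F' Ψ x * (y - x)| ≤ L * (y - x) ^ 2 := by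
  obtain ⟨L, hL0, hL⟩ := h.exists_lipschitz_F'
  refine ⟨L, hL0, fun x hx y hy => ?_⟩
  have hsub : uIcc x y ⊆ Icc (-1 : ℝ) 1 := (convex_Icc (-1 : ℝ) 1).ordConnected.uIcc_subset hx hy
  have hd : ∀ z ∈ uIcc x y,
      HasDerivWithinAt (fun z => F Ψ z - F' Ψ x * z) (F' Ψ z - F' Ψ x) (uIcc x y) z := by
    intro z hz
    have h1 := (h.hasDerivWithinAt_F (hsub hz)).mono hsub
    have h2 := (hasDerivWithinAt_id z (uIcc x y)).const_mul (F' Ψ x)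
    rw [mul_one] at h2
    exact h1.sub h2
  have hb : ∀ z ∈ uIcc x y, ‖F' Ψ z - F' Ψ x‖ ≤ L * |y - x| := fun z hz =>
    (hL z (hsub hz) x hx).trans
      (mul_le_mul_of_nonneg_left (abs_sub_left_of_mem_uIcc hz) hL0)
  have h2 := (convex_uIcc x y).norm_image_sub_le_of_norm_hasDerivWithin_le hd hb
    left_mem_uIcc right_mem_uIcc
  rw [Real.norm_eq_abs, Real.norm_eq_abs, mul_assoc, abs_mul_abs_self, ← sq] at h2
  refine le_of_eq_of_le ?_ h2
  congr 1; ring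

/-- Near `1` the potential is controlled from below by a parabola. -/
theorem exists_quadratic_lower_bound :
    ∃ c : ℝ, 0 < c ∧ ∀ s ∈ Icc (0 : ℝ) 1, c * (1 - s) ^ 2 ≤ Ψ s - s := by
  set m := iteratedDerivWithin 2 Ψ (Icc 0 1) 1 with hm
  have hm0 : 0 < m := h.deriv_two_pos
  have hU : UniqueDiffOn ℝ (Icc (0 : ℝ) 1) := uniqueDiffOn_Icc (by norm_num)
  have h1 : ContDiffOn ℝ 1 (derivWithin Ψ (Icc 0 1)) (Icc 0 1) :=
    h.contDiffOn.derivWithin hU (by norm_num)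
  have h2 : HasDerivWithinAt (derivWithin Ψ (Icc 0 1)) m (Icc 0 1) 1 := by
    have h3 : m = derivWithin (derivWithin Ψ (Icc 0 1)) (Icc 0 1) 1 := by
      rw [hm, iteratedDerivWithin_succ, iteratedDerivWithin_one]
    rw [h3]
    exact (h1.differentiableOn (by norm_num) 1 (by norm_num)).hasDerivWithinAt
  have h4 := (hasDerivWithinAt_iff_isLittleO.1 h2).def (half_pos hm0)
  obtain ⟨δ, hδ0, hδ⟩ := Metric.mem_nhdsWithin_iff.1 h4
  have hf : ∀ s ∈ Ioo (0 : ℝ) 1,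
      HasDerivAt (fun s => Ψ s - s) (derivWithin Ψ (Icc 0 1) s - 1) s := fun s hs =>
    ((h.hasDerivWithinAt (Ioo_subset_Icc_self hs)).hasDerivAt (Icc_mem_nhds hs.1 hs.2)).sub
      (hasDerivAt_id s)
  have hcont : ContinuousOn (fun s => Ψ s - s) (Icc 0 1) :=
    h.contDiffOn.continuousOn.sub continuousOn_id
  obtain ⟨r, hr0, hr1, hrδ⟩ : ∃ r : ℝ, 0 < r ∧ r < 1 ∧ 1 - r < δ :=
    ⟨max (1 / 2) (1 - δ / 2), by positivity, max_lt (by norm_num) (by linarith),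
      by linarith [le_max_right (1 / 2) (1 - δ / 2)]⟩
  have hnear : ∀ s ∈ Icc r 1, m / 4 * (1 - s) ^ 2 ≤ Ψ s - s := by
    -- The difference vanishes at `1`. Near `1` the derivative of `Ψ s - s` is at most `-(m/2)(1 -
    -- s)`, by differentiability of `Ψ'` at `1` with error `m/2`.
    have hanti : AntitoneOn (fun s => Ψ s - s - m / 4 * (1 - s) ^ 2) (Icc r 1) := by
      refine antitoneOn_of_hasDerivWithinAt_nonpos (convex_Icc r 1)
        (f' := fun s => derivWithin Ψ (Icc 0 1) s - 1 + m / 2 * (1 - s)) ?_ ?_ ?_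
      · exact (hcont.mono (Icc_subset_Icc_left hr0.le)).sub (by fun_prop)
      · intro s hs
        rw [interior_Icc] at hs
        have h6 : HasDerivAt (fun s : ℝ => m / 4 * (1 - s) ^ 2) (-(m / 2 * (1 - s))) s := by
          have h7 := ((((hasDerivAt_id s).const_sub 1).pow 2).const_mul (m / 4))
          refine h7.congr_deriv ?_
          simp; ring
        exact (((hf s ⟨hr0.trans hs.1, hs.2⟩).sub h6).congr_deriv (by ring)).hasDerivWithinAt
      · intro s hs
        rw [interior_Icc] at hs
        have h6 := hδ ⟨by rw [Metric.mem_ball, Real.dist_eq, abs_sub_comm, abs_of_pos] <;>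
          linarith [hs.1, hs.2], ⟨(hr0.trans hs.1).le, hs.2.le⟩⟩
        rw [mem_ofPred_eq, h.deriv_one, Real.norm_eq_abs, Real.norm_eq_abs, abs_sub_comm s 1,
          abs_of_pos (sub_pos.2 hs.2), smul_eq_mul] at h6
        have h7 := (abs_le.1 h6).2
        linarith
    intro s hs
    have h8 := hanti hs (right_mem_Icc.2 hr1.le) hs.2
    simp only [h.value_one, sub_self] at h8
    linarith
  -- Away from `1` strict positivity and compactness give a positive lower bound, and `(1 - s)² ≤ 1`
  -- suffices.
  obtain ⟨s₀, hs₀, hmin⟩ := isCompact_Icc.exists_isMinOn (nonempty_Icc.2 hr0.le)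
    (hcont.mono (Icc_subset_Icc_right hr1.le))
  have hc0 : 0 < Ψ s₀ - s₀ := h.sub_id_pos hs₀.1 (hs₀.2.trans_lt hr1)
  refine ⟨min (m / 4) (Ψ s₀ - s₀), lt_min (by positivity) hc0, fun s hs => ?_⟩
  rcases le_total r s with hrs | hrs
  · exact (mul_le_mul_of_nonneg_right (min_le_left _ _) (sq_nonneg _)).trans
      (hnear s ⟨hrs, hs.2⟩)
  · have h9 : Ψ s₀ - s₀ ≤ Ψ s - s := hmin ⟨hs.1, hrs⟩
    refine le_trans ?_ h9
    have h10 : (1 - s) ^ 2 ≤ 1 := by nlinarith [hs.1, hs.2]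
    calc _ ≤ (Ψ s₀ - s₀) * (1 - s) ^ 2 :=
          mul_le_mul_of_nonneg_right (min_le_right _ _) (sq_nonneg _)
      _ ≤ (Ψ s₀ - s₀) * 1 := mul_le_mul_of_nonneg_left h10 hc0.le
      _ = _ := mul_one _

/-- The derivative is `(Ψ' - 1) / (2√(Ψ - s))`. The numerator is at most `M(1 - s)` and the root is
at least `√c (1 - s)`, so the quotient stays bounded up to the zero of `Ψ s - s` at `1`. -/
theorem exists_lipschitz_sqrt :
    ∃ K : ℝ, 0 ≤ K ∧ ∀ x ∈ Icc (0 : ℝ) 1, ∀ y ∈ Icc (0 : ℝ) 1,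
      |√(Ψ x - x) - √(Ψ y - y)| ≤ K * |x - y| := by
  obtain ⟨c, hc0, hc⟩ := h.exists_quadratic_lower_bound
  have h1 : ContDiffOn ℝ 1 (derivWithin Ψ (Icc 0 1)) (Icc 0 1) :=
    h.contDiffOn.derivWithin (uniqueDiffOn_Icc (by norm_num)) (by norm_num)
  obtain ⟨M, hM⟩ := h1.exists_lipschitzOnWith (by norm_num) (convex_Icc _ _) isCompact_Icc
  set K : ℝ := M / (2 * √c) with hK
  have hsc : 0 < √c := Real.sqrt_pos.2 hc0
  have hK0 : 0 ≤ K := by positivity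
  have hcont : ContinuousOn (fun s => √(Ψ s - s)) (Icc 0 1) :=
    (h.contDiffOn.continuousOn.sub continuousOn_id).sqrt
  have hd : ∀ s ∈ Ioo (0 : ℝ) 1, HasDerivAt (fun s => √(Ψ s - s))
      ((derivWithin Ψ (Icc 0 1) s - 1) / (2 * √(Ψ s - s))) s := fun s hs =>
    (((h.hasDerivWithinAt (Ioo_subset_Icc_self hs)).hasDerivAt (Icc_mem_nhds hs.1 hs.2)).sub
      (hasDerivAt_id s)).sqrt (h.sub_id_pos hs.1.le hs.2).ne'
  have hb : ∀ s ∈ Ioo (0 : ℝ) 1, |deriv (fun s => √(Ψ s - s)) s| ≤ K := by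
    intro s hs
    have hs1 : 0 < 1 - s := sub_pos.2 hs.2
    have hlow : √c * (1 - s) ≤ √(Ψ s - s) := by
      refine Real.le_sqrt_of_sq_le ?_
      rw [mul_pow, Real.sq_sqrt hc0.le]
      exact hc s (Ioo_subset_Icc_self hs)
    have hup : |derivWithin Ψ (Icc 0 1) s - 1| ≤ M * (1 - s) := by
      have := hM.dist_le_mul s (Ioo_subset_Icc_self hs) 1 (by norm_num)
      rwa [h.deriv_one, Real.dist_eq, Real.dist_eq, abs_sub_comm s 1, abs_of_pos hs1] at this
    have hpos : 0 < √(Ψ s - s) := lt_of_lt_of_le (by positivity) hlow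
    rw [(hd s hs).deriv, abs_div, abs_of_pos (by positivity : 0 < 2 * √(Ψ s - s)),
      div_le_iff₀ (by positivity)]
    refine hup.trans ?_
    calc (M : ℝ) * (1 - s) = K * (2 * (√c * (1 - s))) := by rw [hK]; field_simp
      _ ≤ K * (2 * √(Ψ s - s)) := by gcongr
  have key : ∀ x ∈ Icc (0 : ℝ) 1, ∀ y ∈ Icc (0 : ℝ) 1, x ≤ y →
      |√(Ψ y - y) - √(Ψ x - x)| ≤ K * (y - x) := by
    intro x hx y hy hxy
    have hdiff : DifferentiableOn ℝ (fun s => √(Ψ s - s)) (interior (Icc 0 1)) := by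
      rw [interior_Icc]
      exact fun s hs => (hd s hs).differentiableAt.differentiableWithinAt
    have h2 := (convex_Icc (0 : ℝ) 1).image_sub_le_mul_sub_of_deriv_le hcont hdiff (C := K)
      (by rw [interior_Icc]; exact fun s hs => (abs_le.1 (hb s hs)).2) x hx y hy hxy
    have h3 := (convex_Icc (0 : ℝ) 1).mul_sub_le_image_sub_of_le_deriv hcont hdiff (C := -K)
      (by rw [interior_Icc]; exact fun s hs => (abs_le.1 (hb s hs)).1) x hx y hy hxy
    exact abs_le.2 ⟨by linarith, h2⟩
  refine ⟨K, hK0, fun x hx y hy => ?_⟩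
  rcases le_total x y with hxy | hxy
  · rw [abs_sub_comm, abs_sub_comm x y, abs_of_nonneg (sub_nonneg.2 hxy)]
    exact key x hx y hy hxy
  · rw [abs_of_nonneg (sub_nonneg.2 hxy)]
    exact key y hy x hx hxy

end IsPotential

/-! ### The first order equation and the heteroclinic profile -/

/-- The truncation of a real number to `[-1, 1]`. -/
def clamp (x : ℝ) : ℝ := max (-1) (min 1 x)

theorem clamp_mem (x : ℝ) : clamp x ∈ Icc (-1 : ℝ) 1 :=
  ⟨le_max_left _ _, max_le (by norm_num) (min_le_left _ _)⟩

theorem clamp_of_mem {x : ℝ} (hx : x ∈ Icc (-1 : ℝ) 1) : clamp x = x := by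
  rw [clamp, min_eq_right hx.2, max_eq_right hx.1]

theorem clamp_of_one_le {x : ℝ} (hx : 1 ≤ x) : clamp x = 1 := by
  rw [clamp, min_eq_left hx]; norm_num

theorem clamp_of_le_neg_one {x : ℝ} (hx : x ≤ -1) : clamp x = -1 := by
  rw [clamp, min_eq_right (by linarith), max_eq_left hx]

theorem monotone_clamp : Monotone clamp := fun _ _ hxy =>
  max_le_max le_rfl (min_le_min le_rfl hxy)

theorem clamp_neg (x : ℝ) : clamp (-x) = -clamp x := by
  rcases le_total x (-1) with h | h
  · rw [clamp_of_le_neg_one h, clamp_of_one_le (by linarith), neg_neg]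
  · rcases le_total 1 x with h' | h'
    · rw [clamp_of_one_le h', clamp_of_le_neg_one (by linarith)]
    · rw [clamp_of_mem ⟨h, h'⟩, clamp_of_mem ⟨by linarith, by linarith⟩]

theorem abs_clamp_sub_le (x y : ℝ) : |clamp x - clamp y| ≤ |x - y| := by
  unfold clamp
  refine (abs_max_sub_max_le_max _ _ _ _).trans ?_
  rw [sub_self, abs_zero, max_eq_right (abs_nonneg _)]
  refine (abs_min_sub_min_le_max _ _ _ _).trans ?_
  rw [sub_self, abs_zero, max_eq_right (abs_nonneg _)]

/-- The right-hand side of the first order equation `u' = √(F(u) / β)` of the heteroclinic profile,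
extended from `[-1, 1]` to the real line. -/
noncomputable def speed (Ψ : ℝ → ℝ) (β x : ℝ) : ℝ := √(F Ψ (clamp x) / β)

theorem speed_nonneg (Ψ : ℝ → ℝ) (β x : ℝ) : 0 ≤ speed Ψ β x := Real.sqrt_nonneg _

theorem speed_neg (Ψ : ℝ → ℝ) (β x : ℝ) : speed Ψ β (-x) = speed Ψ β x := by
  rw [speed, clamp_neg, F_neg, speed]

theorem speed_of_mem (Ψ : ℝ → ℝ) (β : ℝ) {x : ℝ} (hx : x ∈ Icc (-1 : ℝ) 1) :
    speed Ψ β x = √(F Ψ x / β) := by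
  rw [speed, clamp_of_mem hx]

namespace IsPotential

variable {Ψ : ℝ → ℝ} (h : IsPotential Ψ) {β : ℝ}
include h

theorem speed_one : speed Ψ β 1 = 0 := by
  rw [speed_of_mem Ψ β (by norm_num), h.F_one]; simp

theorem speed_pos (hβ : 0 < β) {x : ℝ} (h0 : -1 < x) (h1 : x < 1) : 0 < speed Ψ β x := by
  rw [speed_of_mem Ψ β ⟨h0.le, h1.le⟩]
  exact Real.sqrt_pos.2 (div_pos (h.F_pos h0 h1) hβ)

theorem sq_speed (hβ : 0 < β) {x : ℝ} (hx : x ∈ Icc (-1 : ℝ) 1) :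
    speed Ψ β x ^ 2 = F Ψ x / β := by
  rw [speed_of_mem Ψ β hx, Real.sq_sqrt (div_nonneg (F_nonneg h hx) hβ.le)]

theorem exists_lipschitz_speed (hβ : 0 < β) : ∃ K : NNReal, LipschitzWith K (speed Ψ β) := by
  obtain ⟨K, hK0, hK⟩ := h.exists_lipschitz_sqrt
  have hsβ : 0 < √β := Real.sqrt_pos.2 hβ
  refine ⟨⟨K * 2 / √β, by positivity⟩, LipschitzWith.of_dist_le_mul fun x y => ?_⟩
  rw [Real.dist_eq, Real.dist_eq, speed, speed, F, F,
    Real.sqrt_div (h.sub_id_nonneg (sq_mem_Icc (clamp_mem x))),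
    Real.sqrt_div (h.sub_id_nonneg (sq_mem_Icc (clamp_mem y))), ← sub_div, abs_div,
    abs_of_pos hsβ]
  change _ ≤ K * 2 / √β * |x - y|
  rw [div_mul_eq_mul_div, div_le_div_iff_of_pos_right hsβ, mul_assoc]
  refine (hK _ (sq_mem_Icc (clamp_mem x)) _ (sq_mem_Icc (clamp_mem y))).trans ?_
  refine mul_le_mul_of_nonneg_left ?_ hK0
  have h1 : |clamp x + clamp y| ≤ 2 := abs_le.2
    ⟨by linarith [(clamp_mem x).1, (clamp_mem y).1], by linarith [(clamp_mem x).2, (clamp_mem y).2]⟩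
  calc |clamp x ^ 2 - clamp y ^ 2| = |clamp x + clamp y| * |clamp x - clamp y| := by
        rw [← abs_mul]; congr 1; ring
    _ ≤ 2 * |x - y| := mul_le_mul h1 (abs_clamp_sub_le x y) (abs_nonneg _) (by norm_num)

theorem exists_bound_speed (hβ : 0 < β) : ∃ G : NNReal, ∀ x, |speed Ψ β x| ≤ G := by
  obtain ⟨B, hB0, hB⟩ := h.exists_bound_F
  refine ⟨⟨√(B / β), Real.sqrt_nonneg _⟩, fun x => ?_⟩
  rw [abs_of_nonneg (speed_nonneg _ _ _)]
  exact Real.sqrt_le_sqrt (div_le_div_of_nonneg_right (hB _ (clamp_mem x)) hβ.le)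

end IsPotential

/-- A bounded Lipschitz vector field on the real line has a global integral curve. -/
theorem exists_integralCurve {v : ℝ → ℝ} {K G : NNReal} (hv : LipschitzWith K v)
    (hG : ∀ x, |v x| ≤ G) (x₀ : ℝ) :
    ∃ u : ℝ → ℝ, u 0 = x₀ ∧ ∀ t, HasDerivAt u (v (u t)) t := by
  have hloc : ∀ n : ℕ, ∃ α : ℝ → ℝ, α 0 = x₀ ∧
      ∀ t ∈ Ioo (-(n + 1) : ℝ) (n + 1), HasDerivAt α (v (α t)) t := by
    intro n
    have h0 : (0 : ℝ) ∈ Icc (-(n + 1) : ℝ) (n + 1) := ⟨by linarith [n.cast_nonneg (α := ℝ)],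
      by positivity⟩
    -- The global bound `G` confines solutions to the ball of radius `G(n + 1)` during time `n + 1`,
    -- so the local theorem applies on arbitrarily long intervals.
    have hPL : IsPicardLindelof (fun _ => v) (⟨0, h0⟩ : Icc (-(n + 1) : ℝ) (n + 1)) x₀
        (G * (n + 1)) 0 G K := by
      refine IsPicardLindelof.of_time_independent (fun x _ => hG x) hv.lipschitzOnWith ?_
      simp
    obtain ⟨α, hα0, hα⟩ := hPL.exists_eq_forall_mem_Icc_hasDerivWithinAt₀
    exact ⟨α, hα0, fun t ht =>
      (hα t (Ioo_subset_Icc_self ht)).hasDerivAt (Icc_mem_nhds ht.1 ht.2)⟩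
  choose α hα0 hα using hloc
  have huniq : ∀ m n : ℕ, m ≤ n → EqOn (α m) (α n) (Ioo (-(m + 1) : ℝ) (m + 1)) := by
    intro m n hmn
    have hmn' : (m : ℝ) ≤ n := by exact_mod_cast hmn
    refine ODE_solution_unique_of_mem_Ioo (v := fun _ => v) (s := fun _ => univ) (t₀ := 0) (K := K)
      (fun t _ => hv.lipschitzOnWith)
      ⟨by linarith [m.cast_nonneg (α := ℝ)], by positivity⟩
      (fun t ht => ⟨hα m t ht, mem_univ _⟩)
      (fun t ht => ⟨hα n t ⟨by linarith [ht.1], by linarith [ht.2]⟩, mem_univ _⟩) ?_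
    rw [hα0, hα0]
  have hmem : ∀ (n : ℕ) (t : ℝ), |t| < n + 1 → t ∈ Ioo (-(n + 1) : ℝ) (n + 1) :=
    fun n t ht => abs_lt.1 ht
  have hval : ∀ (n : ℕ) (t : ℝ), |t| < n + 1 → α ⌊|t|⌋₊ t = α n t := by
    intro n t ht
    have h1 : ⌊|t|⌋₊ ≤ n := by
      have : ⌊|t|⌋₊ < n + 1 := (Nat.floor_lt (abs_nonneg t)).2 (by exact_mod_cast ht)
      omega
    exact huniq _ _ h1 (hmem _ _ (Nat.lt_floor_add_one _))
  -- The solution of index `⌊|t|⌋` is defined around `t`; near each point the glued function agrees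
  -- with a single `α n`.
  refine ⟨fun t => α ⌊|t|⌋₊ t, by simp [hα0], fun t => ?_⟩
  obtain ⟨n, hn⟩ := exists_nat_gt |t|
  have hn' : |t| < n + 1 := by linarith
  have hev : (fun t => α ⌊|t|⌋₊ t) =ᶠ[𝓝 t] α n := by
    filter_upwards [Ioo_mem_nhds (hmem n t hn').1 (hmem n t hn').2] with s hs
    exact hval n s (abs_lt.2 hs)
  refine HasDerivAt.congr_of_eventuallyEq ?_ hev
  simp only [hval n t hn']
  exact hα n t (hmem n t hn')

theorem integralCurve_unique {v : ℝ → ℝ} {K : NNReal} (hv : LipschitzWith K v) {f g : ℝ → ℝ}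
    (hf : ∀ t, HasDerivAt f (v (f t)) t) (hg : ∀ t, HasDerivAt g (v (g t)) t) {t₀ : ℝ}
    (h0 : f t₀ = g t₀) : f = g :=
  ODE_solution_unique_univ (v := fun _ => v) (s := fun _ => univ) (K := K)
    (fun _ => hv.lipschitzOnWith) (fun t => ⟨hf t, mem_univ _⟩) (fun t => ⟨hg t, mem_univ _⟩) h0

/-- A function whose derivative is bounded below by a positive constant on a half-line is not
bounded above. -/
theorem not_bounded_of_deriv_ge {u : ℝ → ℝ} (hu : Differentiable ℝ u) {c B a : ℝ} (hc : 0 < c)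
    (hd : ∀ t, a < t → c ≤ deriv u t) (hB : ∀ t, u t ≤ B) : False := by
  have h1 : ∀ t, a ≤ t → c * (t - a) ≤ u t - u a := fun t ht =>
    (convex_Ici a).mul_sub_le_image_sub_of_le_deriv hu.continuous.continuousOn
      hu.differentiableOn (by rw [interior_Ici]; exact hd) a self_mem_Ici t ht ht
  have h2 := h1 (a + (B - u a + 1) / c)
    (by have : 0 ≤ (B - u a + 1) / c := div_nonneg (by linarith [hB a]) hc.le
        linarith)
  rw [add_sub_cancel_left, mul_div_cancel₀ _ hc.ne'] at h2
  linarith [hB (a + (B - u a + 1) / c)]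

theorem mem_Icc_of_mem_M {u : ℝ → ℝ} (hu : u ∈ M) (x : ℝ) : u x ∈ Icc (-1 : ℝ) 1 :=
  ⟨(hu x x le_rfl).1, (hu x x le_rfl).2.2.2⟩

theorem monotone_of_mem_M {u : ℝ → ℝ} (hu : u ∈ M) : Monotone u := fun x y hxy =>
  (hu x y hxy).2.1

theorem map_neg_of_mem_M {u : ℝ → ℝ} (hu : u ∈ M) (x : ℝ) : u (-x) = -u x := by
  linarith [(hu x x le_rfl).2.2.1]

theorem map_zero_of_mem_M {u : ℝ → ℝ} (hu : u ∈ M) : u 0 = 0 := by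
  have := map_neg_of_mem_M hu 0
  rw [neg_zero] at this
  linarith

theorem mem_M {u : ℝ → ℝ} (hmono : Monotone u) (hodd : ∀ x, u (-x) = -u x)
    (hle : ∀ x, u x ≤ 1) : u ∈ M := fun x y hxy =>
  ⟨by linarith [hle (-x), hodd x], hmono hxy, by linarith [hodd y], hle y⟩

namespace IsPotential

variable {Ψ : ℝ → ℝ} (h : IsPotential Ψ) {β : ℝ} (hβ : 0 < β)
include h hβ

/-- A heteroclinic profile solves the first order equation `u' = √(F(u) / β)`. -/
theorem hasDerivAt_of_isHeteroclinic {w : ℝ → ℝ} (hw : IsHeteroclinic Ψ β w) (t : ℝ) :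
    HasDerivAt w (speed Ψ β (w t)) t := by
  obtain ⟨hM, hd1, hd2, heq, htop, -⟩ := hw
  have hFw : ∀ t, HasDerivAt (fun t => F Ψ (w t)) (F' Ψ (w t) * deriv w t) t := fun t =>
    (h.hasDerivWithinAt_F (mem_Icc_of_mem_M hM t)).comp_hasDerivAt t (hd1 t).hasDerivAt
      (Eventually.of_forall fun s => mem_Icc_of_mem_M hM s)
  have hE : ∀ t, HasDerivAt (fun t => β * deriv w t ^ 2 - F Ψ (w t)) 0 t := by
    intro t
    have h1 := (((hd2 t).hasDerivAt.pow 2).const_mul β).sub (hFw t)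
    refine h1.congr_deriv ?_
    have := heq t
    rw [← this]
    push_cast
    ring
  have hconst : ∀ s t, β * deriv w s ^ 2 - F Ψ (w s) = β * deriv w t ^ 2 - F Ψ (w t) :=
    is_const_of_deriv_eq_zero (fun t => (hE t).differentiableAt) fun t => (hE t).deriv
  have hnn : ∀ t, 0 ≤ deriv w t := fun t => (monotone_of_mem_M hM).deriv_nonneg
  set c := β * deriv w 0 ^ 2 - F Ψ (w 0) with hc
  have hFlim : Tendsto (fun t => F Ψ (w t)) atTop (𝓝 0) := by
    have h1 : Tendsto w atTop (𝓝[Icc (-1) 1] 1) :=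
      tendsto_nhdsWithin_iff.2 ⟨htop, Eventually.of_forall fun t => mem_Icc_of_mem_M hM t⟩
    have h2 := (h.continuousOn_F 1 (by norm_num)).tendsto.comp h1
    rwa [h.F_one] at h2
  -- A positive `c` would keep `w' ≥ √(c/β)` and make `w` unbounded. In the other direction `c +
  -- F(w) = β w'² ≥ 0`, while `F(w) → 0`.
  have hc0 : c = 0 := by
    apply le_antisymm
    · by_contra! hpos
      refine not_bounded_of_deriv_ge (c := √(c / β)) (a := 0) (B := 1) hd1
        (Real.sqrt_pos.2 (div_pos hpos hβ)) (fun t _ => ?_) fun t => (mem_Icc_of_mem_M hM t).2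
      refine Real.sqrt_le_iff.2 ⟨hnn t, ?_⟩
      rw [div_le_iff₀ hβ]
      linarith [hconst 0 t, F_nonneg h (mem_Icc_of_mem_M hM t)]
    · have : Tendsto (fun t => c + F Ψ (w t)) atTop (𝓝 (c + 0)) := hFlim.const_add c
      rw [add_zero] at this
      refine ge_of_tendsto' this fun t => ?_
      have := hconst 0 t
      nlinarith [sq_nonneg (deriv w t), mul_nonneg hβ.le (sq_nonneg (deriv w t))]
  have hval : deriv w t = speed Ψ β (w t) := by
    rw [speed_of_mem Ψ β (mem_Icc_of_mem_M hM t)]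
    refine ((Real.sqrt_eq_iff_eq_sq (div_nonneg (F_nonneg h (mem_Icc_of_mem_M hM t)) hβ.le)
      (hnn t)).2 ?_).symm
    rw [div_eq_iff hβ.ne']
    linarith [hconst 0 t]
  rw [← hval]
  exact (hd1 t).hasDerivAt

theorem isHeteroclinic_unique {u w : ℝ → ℝ} (hu : IsHeteroclinic Ψ β u)
    (hw : IsHeteroclinic Ψ β w) : w = u := by
  obtain ⟨K, hK⟩ := h.exists_lipschitz_speed hβ
  exact integralCurve_unique hK (h.hasDerivAt_of_isHeteroclinic hβ hw)
    (h.hasDerivAt_of_isHeteroclinic hβ hu) (t₀ := 0)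
    ((map_zero_of_mem_M hw.1).trans (map_zero_of_mem_M hu.1).symm)

/-- The profile is the integral curve of `speed` through `0`. Each remaining property comes from the
flow: `speed` is even, so `-u(-t)` is the same curve; the constant `1` is another curve, so `u`
never reaches it; and a limit below `1` would leave a positive residual speed. -/
theorem exists_isHeteroclinic : ∃ u : ℝ → ℝ, IsHeteroclinic Ψ β u := by
  obtain ⟨K, hK⟩ := h.exists_lipschitz_speed hβ
  obtain ⟨G, hG⟩ := h.exists_bound_speed hβ
  obtain ⟨u, hu0, hu⟩ := exists_integralCurve hK hG 0
  have hdiff : Differentiable ℝ u := fun t => (hu t).differentiableAt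
  have hmono : Monotone u := monotone_of_deriv_nonneg hdiff fun t => by
    rw [(hu t).deriv]; exact speed_nonneg _ _ _
  have hodd : ∀ t, u (-t) = -u t := by
    have h1 : ∀ t, HasDerivAt (fun t => -u (-t)) (speed Ψ β (-u (-t))) t := fun t => by
      have := ((hu (-t)).scomp t (hasDerivAt_neg t)).neg
      rw [speed_neg]
      exact this.congr_deriv (by simp)
    have h2 := integralCurve_unique hK h1 hu (t₀ := 0) (by simp [hu0])
    intro t
    have := congrFun h2 t
    linarith
  have hone : ∀ t, u t ≠ 1 := by
    intro t ht
    have h1 : ∀ t, HasDerivAt (fun _ : ℝ => (1 : ℝ)) (speed Ψ β 1) t := fun t => by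
      rw [h.speed_one]; exact hasDerivAt_const t 1
    have h2 := congrFun (integralCurve_unique hK hu h1 ht) 0
    rw [hu0] at h2
    norm_num at h2
  have hlt : ∀ t, u t < 1 := by
    intro t
    by_contra! hge
    obtain ⟨s, hs⟩ := mem_range_of_exists_le_of_exists_ge hdiff.continuous
      ⟨0, by rw [hu0]; norm_num⟩ ⟨t, hge⟩
    exact hone s hs
  have hgt : ∀ t, -1 < u t := fun t => by linarith [hlt (-t), hodd t]
  have hM : u ∈ M := mem_M hmono hodd fun t => (hlt t).le
  have hderiv : deriv u = fun t => √(F Ψ (u t) / β) := funext fun t => by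
    rw [(hu t).deriv, speed_of_mem Ψ β (mem_Icc_of_mem_M hM t)]
  -- The square root can be differentiated because `|u| < 1` strictly, so `F(u) > 0`.
  have hd2 : ∀ t, HasDerivAt (deriv u) (F' Ψ (u t) / (2 * β)) t := by
    intro t
    have h1 : HasDerivAt (fun t => F Ψ (u t) / β) (F' Ψ (u t) * deriv u t / β) t :=
      ((h.hasDerivWithinAt_F (mem_Icc_of_mem_M hM t)).comp_hasDerivAt t (hdiff t).hasDerivAt
        (Eventually.of_forall fun s => mem_Icc_of_mem_M hM s)).div_const β
    have hpos : 0 < F Ψ (u t) / β := div_pos (h.F_pos (hgt t) (hlt t)) hβ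
    have h2 := h1.sqrt hpos.ne'
    rw [← hderiv] at h2
    refine h2.congr_deriv ?_
    rw [show √(F Ψ (u t) / β) = deriv u t by rw [hderiv]]
    have : deriv u t ≠ 0 := by rw [hderiv]; exact (Real.sqrt_pos.2 hpos).ne'
    field_simp
  have htop : Tendsto u atTop (𝓝 1) := by
    have h1 := tendsto_atTop_ciSup hmono ⟨1, by rintro _ ⟨t, rfl⟩; exact (hlt t).le⟩
    set l := ⨆ t, u t with hl
    have hul : ∀ t, u t ≤ l := fun t => hmono.ge_of_tendsto h1 t
    have hl1 : l ≤ 1 := le_of_tendsto' h1 fun t => (hlt t).le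
    rcases hl1.lt_or_eq with hlt1 | heq
    · exfalso
      have h2 : Tendsto (fun t => speed Ψ β (u t)) atTop (𝓝 (speed Ψ β l)) :=
        (hK.continuous.tendsto l).comp h1
      have h3 : 0 < speed Ψ β l :=
        h.speed_pos hβ (by linarith [hul 0, hu0]) hlt1
      obtain ⟨a, ha⟩ := eventually_atTop.1 (h2.eventually (lt_mem_nhds (half_lt_self h3)))
      refine not_bounded_of_deriv_ge (a := a) (B := 1) hdiff (half_pos h3) (fun t ht => ?_)
        fun t => (hlt t).le
      rw [(hu t).deriv]
      exact (ha t ht.le).le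
    · rwa [heq] at h1
  refine ⟨u, hM, hdiff, fun t => (hd2 t).differentiableAt, fun t => ?_, htop, ?_⟩
  · rw [(hd2 t).deriv]; field_simp
  · have h1 : Tendsto (fun t => -u (-t)) atBot (𝓝 (-1)) :=
      (htop.comp tendsto_neg_atBot_atTop).neg
    refine h1.congr fun t => ?_
    rw [hodd, neg_neg]

end IsPotential

/-! ### Lattice minimizers and the discrete standing wave equation -/

/-- The monotone lattice profiles with values in `[-1, 1]` that are odd with respect to the
reflection `k ↦ -σ - k`. -/
def latticeM (σ : ℤ) : Set (ℤ → ℝ) :=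
  {a | Monotone a ∧ (∀ k, a (-σ - k) = -a k) ∧ ∀ k, a k ≤ 1}

/-- The lattice energy with coupling constant `κ`. -/
noncomputable def latticeEnergy (Ψ : ℝ → ℝ) (κ : ℝ) (a : ℤ → ℝ) : ℝ≥0∞ :=
  ∑' k, ENNReal.ofReal (F Ψ (a k) + κ * (a (k + 1) - a k) ^ 2)

/-- `a` minimizes the lattice energy. -/
def IsLatticeMinimizer (Ψ : ℝ → ℝ) (κ : ℝ) (σ : ℤ) (a : ℤ → ℝ) : Prop :=
  a ∈ latticeM σ ∧ ∀ b ∈ latticeM σ, latticeEnergy Ψ κ a ≤ latticeEnergy Ψ κ b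

theorem mem_Icc_of_mem_latticeM {σ : ℤ} {a : ℤ → ℝ} (ha : a ∈ latticeM σ) (k : ℤ) :
    a k ∈ Icc (-1 : ℝ) 1 :=
  ⟨by linarith [ha.2.1 k, ha.2.2 (-σ - k)], ha.2.2 k⟩

theorem isCompact_latticeM (σ : ℤ) : IsCompact (latticeM σ) := by
  have h1 : IsCompact (Set.pi univ fun _ : ℤ => Icc (-1 : ℝ) 1) :=
    isCompact_univ_pi fun _ => isCompact_Icc
  refine h1.of_isClosed_subset ?_ fun a ha k _ => mem_Icc_of_mem_latticeM ha k
  have h2 : latticeM σ = {a : ℤ → ℝ | Monotone a} ∩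
      ((⋂ k, {a | a (-σ - k) = -a k}) ∩ ⋂ k, {a | a k ≤ 1}) := by
    ext a; simp [latticeM]
  rw [h2]
  refine isClosed_monotone.inter (IsClosed.inter ?_ ?_)
  · exact isClosed_iInter fun k => isClosed_eq (continuous_apply _) (continuous_apply _).neg
  · exact isClosed_iInter fun k => isClosed_le (continuous_apply _) continuous_const

/-- The smallest index of a monotone sequence with a given value, provided the sequence is smaller
somewhere. -/
theorem exists_first_index {a : ℤ → ℝ} (ha : Monotone a) {j i : ℤ} (hi : a i < a j) :
    ∃ m ≤ j, a m = a j ∧ a (m - 1) < a j := by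
  obtain ⟨m, hm, hmin⟩ := Int.exists_least_of_bdd (P := fun k => a k = a j)
    ⟨i, fun k hk => by
      by_contra! hlt
      exact absurd (ha hlt.le) (by rw [hk]; exact not_le.2 hi)⟩ ⟨j, rfl⟩
  refine ⟨m, hmin j rfl, hm, lt_of_le_of_ne ((ha (by omega)).trans hm.le) fun heq => ?_⟩
  have := hmin (m - 1) heq
  omega

theorem exists_last_index {a : ℤ → ℝ} (ha : Monotone a) {j i : ℤ} (hi : a j < a i) :
    ∃ m, j ≤ m ∧ a m = a j ∧ a j < a (m + 1) := by
  obtain ⟨m, hm, hmax⟩ := Int.exists_greatest_of_bdd (P := fun k => a k = a j)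
    ⟨i, fun k hk => by
      by_contra! hlt
      exact absurd (ha hlt.le) (by rw [hk]; exact not_le.2 hi)⟩ ⟨j, rfl⟩
  refine ⟨m, hmax j rfl, hm, lt_of_le_of_ne (hm.ge.trans (ha (by omega))) fun heq => ?_⟩
  have := hmax (m + 1) heq.symm
  omega

/-- The perturbation direction `e_i - e_j`. -/
def bump (i j k : ℤ) : ℝ := (if k = i then 1 else 0) - if k = j then 1 else 0

theorem hasSum_congr_fun {f g : ℤ → ℝ} {s : ℝ} (hf : HasSum f s) (hfg : ∀ k, g k = f k) :
    HasSum g s := by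
  rwa [funext hfg]

theorem hasSum_bump_mul (i j m : ℤ) (c : ℤ → ℝ) :
    HasSum (fun k => bump i j (k + m) * c k) (c (i - m) - c (j - m)) := by
  have h1 := (hasSum_ite_eq (i - m) (c (i - m))).sub (hasSum_ite_eq (j - m) (c (j - m)))
  refine hasSum_congr_fun h1 fun k => ?_
  have e1 : k + m = i ↔ k = i - m := by omega
  have e2 : k + m = j ↔ k = j - m := by omega
  simp only [bump, e1, e2, sub_mul, ite_mul, one_mul, zero_mul]
  congr 1 <;> split_ifs with hk <;> simp [hk]

theorem mul_bump (t : ℝ) (i j k : ℤ) :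
    t * bump i j k = (if k = i then t else 0) - if k = j then t else 0 := by
  simp [bump, mul_sub]

/-- Extracts the sign of the first variation from one-sided perturbations, the only ones the
monotonicity constraint may allow. -/
theorem nonneg_of_forall_small {g C q : ℝ} (hq : 0 < q)
    (hg : ∀ t, 0 < t → t ≤ q → 0 ≤ t * g + t ^ 2 * C) : 0 ≤ g := by
  by_contra! hneg
  set t := min q (-g / (2 * (|C| + 1))) with ht
  have hC : 0 < |C| + 1 := by positivity
  have ht0 : 0 < t := lt_min hq (div_pos (by linarith) (by positivity))
  have h1 := hg t ht0 (min_le_left _ _)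
  have h2 : t * (2 * (|C| + 1)) ≤ -g := (le_div_iff₀ (by positivity)).1 (min_le_right _ _)
  have h3 : 0 ≤ g + t * C := by
    by_contra! h4
    nlinarith
  nlinarith [le_abs_self C]

section Variation

variable {σ : ℤ} {a : ℤ → ℝ} {j : ℤ} {t : ℝ}

/-- Moving `a j` by `t` forces its mirror image to move by `-t`. The factor `2` matters when the two
sites are neighbours, `j - 1 = -σ - j`: then the gap below `j` changes by `2t`. -/
theorem add_bump_mem_latticeM (ha : a ∈ latticeM σ) (hj : 0 < 2 * j + σ)
    (h1 : -(a j - a (j - 1)) ≤ 2 * t) (h2 : 2 * t ≤ a (j + 1) - a j) :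
    (fun k => a k + t * bump j (-σ - j) k) ∈ latticeM σ := by
  obtain ⟨hm, ho, hle⟩ := ha
  have e1 : a (-σ - j) = -a j := ho j
  have e2 : a (-σ - j + 1) = -a (j - 1) := by rw [← ho]; congr 1; ring
  have e3 : a (-σ - j - 1) = -a (j + 1) := by rw [← ho]; congr 1; ring
  have m1 : a (j - 1) ≤ a j := hm (by omega)
  have m2 : a j ≤ a (j + 1) := hm (by omega)
  refine ⟨monotone_int_of_le_succ fun k => ?_, fun k => ?_, fun k => ?_⟩
  · have m3 : a k ≤ a (k + 1) := hm (by omega)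
    simp only [mul_bump]
    split_ifs <;> grind
  · simp only [mul_bump, ho]
    grind
  · simp only [mul_bump]
    have m3 := hle k
    have m4 := hle (j + 1)
    have m5 := hle (-σ - (j - 1))
    rw [ho] at m5
    clear hm ho hle
    split_ifs with c1 c2 c2
    · omega
    · subst c1; linarith
    · subst c2; linarith
    · linarith

end Variation

namespace IsPotential

variable {Ψ : ℝ → ℝ} (h : IsPotential Ψ)
include h

/-- Direct method in the product topology: a sum of continuous nonnegative terms is lower
semicontinuous. `clamp` only serves to make the terms continuous on all sequences. The minimum is
not yet known to be finite. -/
theorem exists_isLatticeMinimizer (κ : ℝ) (σ : ℤ) :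
    ∃ a, IsLatticeMinimizer Ψ κ σ a := by
  have hFc : Continuous fun x => F Ψ (clamp x) :=
    h.continuousOn_F.comp_continuous (by unfold clamp; fun_prop) clamp_mem
  have hlsc : LowerSemicontinuous fun a : ℤ → ℝ =>
      ∑' k, ENNReal.ofReal (F Ψ (clamp (a k)) + κ * (a (k + 1) - a k) ^ 2) := by
    refine lowerSemicontinuous_tsum fun k => Continuous.lowerSemicontinuous ?_
    have := hFc.comp (continuous_apply (A := fun _ : ℤ => ℝ) k)
    refine ENNReal.continuous_ofReal.comp (this.add ?_)
    fun_prop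
  have hne : (latticeM σ).Nonempty := ⟨fun _ => 0, monotone_const, by simp, by simp⟩
  obtain ⟨a, ha, hmin⟩ := (hlsc.lowerSemicontinuousOn _).exists_isMinOn hne (isCompact_latticeM σ)
  have heq : ∀ b ∈ latticeM σ, latticeEnergy Ψ κ b =
      ∑' k, ENNReal.ofReal (F Ψ (clamp (b k)) + κ * (b (k + 1) - b k) ^ 2) := fun b hb =>
    tsum_congr fun k => by rw [clamp_of_mem (mem_Icc_of_mem_latticeM hb k)]
  refine ⟨a, ha, fun b hb => ?_⟩
  rw [heq a ha, heq b hb]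
  exact hmin hb

variable {κ : ℝ} (hκ : 0 < κ) {σ : ℤ} {a : ℤ → ℝ}
include hκ

theorem density_nonneg (ha : a ∈ latticeM σ) (k : ℤ) :
    0 ≤ F Ψ (a k) + κ * (a (k + 1) - a k) ^ 2 :=
  add_nonneg (F_nonneg h (mem_Icc_of_mem_latticeM ha k)) (by positivity)

theorem summable_density (ha : a ∈ latticeM σ) (hfin : latticeEnergy Ψ κ a ≠ ⊤) :
    Summable fun k => F Ψ (a k) + κ * (a (k + 1) - a k) ^ 2 :=
  (ENNReal.summable_toReal hfin).congr fun k =>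
    ENNReal.toReal_ofReal (h.density_nonneg hκ ha k)

theorem summable_F (ha : a ∈ latticeM σ) (hfin : latticeEnergy Ψ κ a ≠ ⊤) :
    Summable fun k => F Ψ (a k) :=
  (h.summable_density hκ ha hfin).of_nonneg_of_le
    (fun k => F_nonneg h (mem_Icc_of_mem_latticeM ha k)) fun k => by
      have : 0 ≤ κ * (a (k + 1) - a k) ^ 2 := by positivity
      linarith

theorem summable_sq_diff (ha : a ∈ latticeM σ) (hfin : latticeEnergy Ψ κ a ≠ ⊤) :
    Summable fun k => (a (k + 1) - a k) ^ 2 := by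
  have h1 : Summable fun k => κ * (a (k + 1) - a k) ^ 2 :=
    (h.summable_density hκ ha hfin).of_nonneg_of_le (fun k => by positivity) fun k => by
      linarith [F_nonneg h (mem_Icc_of_mem_latticeM ha k)]
  exact (summable_mul_left_iff hκ.ne').1 h1

theorem latticeEnergy_eq (ha : a ∈ latticeM σ)
    (hs : Summable fun k => F Ψ (a k) + κ * (a (k + 1) - a k) ^ 2) :
    latticeEnergy Ψ κ a = ENNReal.ofReal (∑' k, (F Ψ (a k) + κ * (a (k + 1) - a k) ^ 2)) :=
  (ENNReal.ofReal_tsum_of_nonneg (h.density_nonneg hκ ha) hs).symm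

/-- Summability of `F (a k)` makes the monotone limit a zero of `F`, and oddness makes it
nonnegative. -/
theorem tendsto_one (ha : a ∈ latticeM σ) (hfin : latticeEnergy Ψ κ a ≠ ⊤) :
    Tendsto a atTop (𝓝 1) := by
  have hbdd : BddAbove (range a) := ⟨1, by rintro _ ⟨k, rfl⟩; exact ha.2.2 k⟩
  have h1 := tendsto_atTop_ciSup ha.1 hbdd
  set l := ⨆ k, a k with hl
  have hle : ∀ k, a k ≤ l := fun k => le_ciSup hbdd k
  have hl1 : l ≤ 1 := ciSup_le ha.2.2
  have hl0 : 0 ≤ l := by linarith [hle 0, hle (-σ - 0), ha.2.1 0]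
  have hlmem : l ∈ Icc (-1 : ℝ) 1 := ⟨by linarith, hl1⟩
  have h2 : Tendsto (fun k => F Ψ (a k)) atTop (𝓝 (F Ψ l)) :=
    (h.continuousOn_F l hlmem).tendsto.comp
      (tendsto_nhdsWithin_iff.2 ⟨h1, Eventually.of_forall fun k => mem_Icc_of_mem_latticeM ha k⟩)
  have h3 : Tendsto (fun k => F Ψ (a k)) atTop (𝓝 0) :=
    (h.summable_F hκ ha hfin).tendsto_cofinite_zero.mono_left (by
      rw [Int.cofinite_eq]; exact le_sup_right)
  have h4 := tendsto_nhds_unique h2 h3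
  rcases hl1.lt_or_eq with hlt | heq
  · exact absurd h4 (h.F_pos (by linarith) hlt).ne'
  · rwa [heq] at h1

/-- A finitely supported change of the energy density of a minimizer is nonnegative in total. -/
theorem nonneg_of_hasSum_sub (ha : IsLatticeMinimizer Ψ κ σ a) (hfin : latticeEnergy Ψ κ a ≠ ⊤)
    {b : ℤ → ℝ} (hb : b ∈ latticeM σ) {D : ℝ}
    (hD : HasSum (fun k => (F Ψ (b k) + κ * (b (k + 1) - b k) ^ 2) -
      (F Ψ (a k) + κ * (a (k + 1) - a k) ^ 2)) D) : 0 ≤ D := by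
  have h1 := (h.summable_density hκ ha.1 hfin)
  have h2 := hD.add h1.hasSum
  simp only [sub_add_cancel] at h2
  have h3 := ha.2 b hb
  rw [h.latticeEnergy_eq hκ ha.1 h1, h.latticeEnergy_eq hκ hb h2.summable, h2.tsum_eq] at h3
  have h4 : 0 ≤ D + ∑' k, (F Ψ (a k) + κ * (a (k + 1) - a k) ^ 2) :=
    h2.nonneg fun k => h.density_nonneg hκ hb k
  have h5 := (ENNReal.ofReal_le_ofReal_iff h4).1 h3
  linarith

/-- The first variation of the lattice energy in the direction `e_j - e_{-σ-j}`. -/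
theorem exists_first_variation (ha : IsLatticeMinimizer Ψ κ σ a)
    (hfin : latticeEnergy Ψ κ a ≠ ⊤) {j : ℤ} (hj : 0 < 2 * j + σ) :
    ∃ C : ℝ, ∀ t : ℝ, -(a j - a (j - 1)) ≤ 2 * t → 2 * t ≤ a (j + 1) - a j →
      0 ≤ t * (F' Ψ (a j) - 2 * κ * (a (j + 1) + a (j - 1) - 2 * a j)) + t ^ 2 * C := by
  obtain ⟨L, hL0, hL⟩ := h.exists_taylor_F
  set i := -σ - j with hi
  have hij : j ≠ i := by omega
  set η := bump j i with hη
  -- `S` is `∑ (η (k + 1) - η k)²`. By oddness the sites `j` and `i` contribute equally to the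
  -- linear terms and to the change of `F`; dividing the total by `2` leaves `L + κ * S / 2` in
  -- front of `t²`.
  set S := (η j - η (j - 1) - (η i - η (i - 1))) -
    (η (j + 1) - η j - (η (i + 1) - η i)) with hS
  refine ⟨L + κ * S / 2, fun t ht1 ht2 => ?_⟩
  have hb := add_bump_mem_latticeM ha.1 hj ht1 ht2
  have hm1 : a (j - 1) ≤ a j := ha.1.1 (by omega)
  have hm2 : a j ≤ a (j + 1) := ha.1.1 (by omega)
  have hmem := mem_Icc_of_mem_latticeM ha.1
  have hmem' : a j + t ∈ Icc (-1 : ℝ) 1 :=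
    ⟨by linarith [(hmem (j - 1)).1], by linarith [(hmem (j + 1)).2]⟩
  have e1 : a i = -a j := ha.1.2.1 j
  have e2 : a (i + 1) = -a (j - 1) := by rw [← ha.1.2.1]; congr 1; omega
  have e3 : a (i - 1) = -a (j + 1) := by rw [← ha.1.2.1]; congr 1; omega
  have hηΔ : ∀ c : ℤ → ℝ, HasSum (fun k => (η (k + 1) - η k) * c k)
      (c (j - 1) - c (i - 1) - (c j - c i)) := fun c => by
    have h1 := (hasSum_bump_mul j i 1 c).sub (hasSum_bump_mul j i 0 c)
    simpa only [add_zero, sub_zero, ← sub_mul] using h1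
  have hF : HasSum (fun k => F Ψ (a k + t * η k) - F Ψ (a k))
      (2 * (F Ψ (a j + t) - F Ψ (a j))) := by
    have h1 := (hasSum_ite_eq j (F Ψ (a j + t) - F Ψ (a j))).add
      (hasSum_ite_eq i (F Ψ (a i - t) - F Ψ (a i)))
    have h2 : F Ψ (a i - t) - F Ψ (a i) = F Ψ (a j + t) - F Ψ (a j) := by
      rw [e1, F_neg, ← F_neg Ψ (a j + t)]; ring_nf
    have h3 : F Ψ (a j + t) - F Ψ (a j) + (F Ψ (a i - t) - F Ψ (a i)) =
        2 * (F Ψ (a j + t) - F Ψ (a j)) := by rw [h2]; ring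
    rw [h3] at h1
    refine hasSum_congr_fun h1 fun k => ?_
    simp only [hη, mul_bump]
    by_cases c1 : k = j
    · have c2 : k ≠ i := c1 ▸ hij
      simp [c1, hij]
    · by_cases c2 : k = i
      · simp [c2, hij.symm, sub_eq_add_neg]
      · simp [c1, c2]
  have hD := hF.add ((((hηΔ fun k => a (k + 1) - a k).mul_left (2 * t)).add
    ((hηΔ fun k => η (k + 1) - η k).mul_left (t ^ 2))).mul_left κ)
  have hpos := h.nonneg_of_hasSum_sub hκ ha hfin hb (D := _) (by
    refine hasSum_congr_fun hD fun k => ?_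
    ring)
  rw [sub_add_cancel, sub_add_cancel, e1, e2, e3] at hpos
  have hT := (abs_le.1 (hL (a j) (hmem j) (a j + t) hmem')).2
  rw [add_sub_cancel_left] at hT
  rw [hS]
  linarith

/-- A strict gap above `j` leaves room for `t > 0`, a strict gap below for `t < 0`; each gives one
half of the discrete equation. -/
theorem force_nonneg (ha : IsLatticeMinimizer Ψ κ σ a) (hfin : latticeEnergy Ψ κ a ≠ ⊤) {j : ℤ}
    (hj : 0 < 2 * j + σ) (hlt : a j < a (j + 1)) :
    2 * κ * (a (j + 1) + a (j - 1) - 2 * a j) ≤ F' Ψ (a j) := by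
  obtain ⟨C, hC⟩ := h.exists_first_variation hκ ha hfin hj
  have hm1 : a (j - 1) ≤ a j := ha.1.1 (by omega)
  exact sub_nonneg.1 (nonneg_of_forall_small (half_pos (sub_pos.2 hlt)) fun t ht0 ht =>
    hC t (by linarith) (by linarith))

theorem force_nonpos (ha : IsLatticeMinimizer Ψ κ σ a) (hfin : latticeEnergy Ψ κ a ≠ ⊤) {j : ℤ}
    (hj : 0 < 2 * j + σ) (hlt : a (j - 1) < a j) :
    F' Ψ (a j) ≤ 2 * κ * (a (j + 1) + a (j - 1) - 2 * a j) := by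
  obtain ⟨C, hC⟩ := h.exists_first_variation hκ ha hfin hj
  have hm1 : a j ≤ a (j + 1) := ha.1.1 (by omega)
  have := nonneg_of_forall_small (g := -(F' Ψ (a j) -
    2 * κ * (a (j + 1) + a (j - 1) - 2 * a j))) (C := C) (half_pos (sub_pos.2 hlt))
    fun t ht0 ht => by
      have := hC (-t) (by linarith) (by linarith)
      linarith
  linarith

/-- On a plateau of height below `1`, the last site can be raised and its second difference is
positive, so `F' > 0` there, which excludes height `0`. At positive height the first site can be
lowered and its second difference is negative, so `F' < 0`, a contradiction. At height `1` the first
site alone contradicts `F'(1) = 0`. -/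
theorem lt_succ_of_minimizer (ha : IsLatticeMinimizer Ψ κ σ a) (hfin : latticeEnergy Ψ κ a ≠ ⊤)
    {j : ℤ} (hj : 0 ≤ 2 * j + σ) : a j < a (j + 1) := by
  have hmono := ha.1.1
  have hodd := ha.1.2.1
  have hle1 := ha.1.2.2
  have hidx : ∀ k, 0 < a k → 0 < 2 * k + σ := fun k hk => by
    by_contra! hneg
    have := hmono (show k ≤ -σ - k by omega)
    rw [hodd] at this
    linarith
  have hnn : 0 ≤ a j := by
    have := hmono (show -σ - j ≤ j by omega)
    rw [hodd] at this
    linarith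
  by_contra! hge
  have heq : a (j + 1) = a j := le_antisymm hge (hmono (by omega))
  rcases (hle1 j).lt_or_eq with hlt | hone
  · obtain ⟨i, hi⟩ := ((h.tendsto_one hκ ha.1 hfin).eventually (lt_mem_nhds hlt)).exists
    obtain ⟨p, hjp, hp, hp'⟩ := exists_last_index hmono (heq.trans_lt hi)
    have hp1 : a (p - 1) = a j :=
      le_antisymm ((hmono (by omega)).trans (hp.trans heq).le) (hmono (by omega))
    have h1 := h.force_nonneg hκ ha hfin (j := p) (by omega) (by rw [hp]; exact hp')
    rw [hp1, hp, heq] at h1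
    rw [heq] at hp'
    have h2 : 0 < F' Ψ (a j) := lt_of_lt_of_le (mul_pos (by positivity) (by linarith)) h1
    rcases hnn.eq_or_lt with h0 | h0
    · rw [← h0, h.F'_zero] at h2
      exact lt_irrefl _ h2
    · obtain ⟨q, hqj, hq, hq'⟩ := exists_first_index hmono (j := j) (i := -σ - j)
        (by rw [hodd]; linarith)
      have hq1 : a (q + 1) = a j :=
        le_antisymm ((hmono (by omega)).trans heq.le) (hq.ge.trans (hmono (by omega)))
      have h3 := h.force_nonpos hκ ha hfin (hidx q (by rw [hq]; exact h0)) (by rw [hq]; exact hq')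
      rw [hq1, hq] at h3
      have h4 : 2 * κ * (a j + a (q - 1) - 2 * a j) < 0 :=
        mul_neg_of_pos_of_neg (by positivity) (by linarith)
      linarith
  · obtain ⟨q, hqj, hq, hq'⟩ := exists_first_index hmono (j := j) (i := -σ - j)
      (by rw [hodd, hone]; norm_num)
    have hq1 : a (q + 1) = a j :=
      le_antisymm ((hmono (by omega)).trans heq.le) (hq.ge.trans (hmono (by omega)))
    have h3 := h.force_nonpos hκ ha hfin (hidx q (by rw [hq, hone]; norm_num))
      (by rw [hq]; exact hq')
    rw [hq1, hq, hone, h.F'_one] at h3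
    have h4 : 2 * κ * (1 + a (q - 1) - 2 * 1) < 0 :=
      mul_neg_of_pos_of_neg (by positivity) (by linarith)
    linarith

/-- The discrete standing wave equation. -/
theorem euler_lagrange (ha : IsLatticeMinimizer Ψ κ σ a)
    (hfin : latticeEnergy Ψ κ a ≠ ⊤) (j : ℤ) :
    F' Ψ (a j) = 2 * κ * (a (j + 1) + a (j - 1) - 2 * a j) := by
  have hodd := ha.1.2.1
  have hmem := mem_Icc_of_mem_latticeM ha.1
  have hpos : ∀ j, 0 < 2 * j + σ →
      F' Ψ (a j) = 2 * κ * (a (j + 1) + a (j - 1) - 2 * a j) := by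
    intro j hj
    have hup := h.lt_succ_of_minimizer hκ ha hfin hj.le
    refine le_antisymm (h.force_nonpos hκ ha hfin hj ?_) (h.force_nonneg hκ ha hfin hj hup)
    by_cases hj' : 0 ≤ 2 * (j - 1) + σ
    · simpa using h.lt_succ_of_minimizer hκ ha hfin hj'
    -- Here `2j + σ = 1`, so `j - 1` is the mirror image of `j`. Without a gap `a j = 0`, and
    -- raising `a j` contradicts `F'(0) = 0`.
    · have e : a (j - 1) = -a j := by rw [← hodd]; congr 1; omega
      have hm := ha.1.1 (show j - 1 ≤ j by omega)
      by_contra! hge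
      have h0 : a j = 0 := by linarith
      have h1 := h.force_nonneg hκ ha hfin hj hup
      rw [e, h0, h.F'_zero] at h1
      rw [h0] at hup
      have : 0 < 2 * κ * (a (j + 1) + -0 - 2 * 0) := by
        have : 0 < a (j + 1) + -0 - 2 * 0 := by linarith
        positivity
      linarith
  rcases lt_trichotomy 0 (2 * j + σ) with hj | hj | hj
  · exact hpos j hj
  · have e0 : a j = 0 := by
      have := hodd j
      rw [show -σ - j = j by omega] at this
      linarith
    have e1 : a (j - 1) = -a (j + 1) := by rw [← hodd]; congr 1; omega
    rw [e0, e1, h.F'_zero]; ring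
  · have h1 := hpos (-σ - j) (by omega)
    have e2 : a (-σ - j + 1) = -a (j - 1) := by rw [← hodd]; congr 1; omega
    have e3 : a (-σ - j - 1) = -a (j + 1) := by rw [← hodd]; congr 1; omega
    rw [hodd, e2, e3, h.F'_neg (hmem j)] at h1
    linarith

end IsPotential

/-! ### From lattice sequences to profiles on the line -/

/-- The lattice `σ / 2 + ℤ`. -/
def latticeSet (σ : ℤ) : Set ℝ := Set.range fun k : ℤ => (σ : ℝ) / 2 + k

theorem onSite_eq : onSite = latticeSet 0 := by simp [onSite, latticeSet]

theorem interSite_eq : interSite = latticeSet 1 := by simp [interSite, latticeSet]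

/-- The open cell of length `ε` around the lattice point `ε (σ / 2 + k)`. -/
noncomputable def cell (ε : ℝ) (σ k : ℤ) : Set ℝ := Ioo (ε * (σ / 2 + k - 1 / 2)) (ε * (σ / 2 + k + 1 / 2))

/-- The restriction of a function to the lattice. -/
noncomputable def sample (ε : ℝ) (σ : ℤ) (v : ℝ → ℝ) (k : ℤ) : ℝ := v (ε * (σ / 2 + k))

/-- The piecewise constant function with given values on the cells, taking the mean of the two
one-sided limits at the cell boundaries. -/
noncomputable def ofLattice (ε : ℝ) (σ : ℤ) (a : ℤ → ℝ) (ξ : ℝ) : ℝ :=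
  (a ⌊ξ / ε - σ / 2 + 1 / 2⌋ + a ⌈ξ / ε - σ / 2 - 1 / 2⌉) / 2

theorem add_mem_cell {ε : ℝ} {σ k : ℤ} {ξ : ℝ} (hξ : ξ ∈ cell ε σ k) : ξ + ε ∈ cell ε σ (k + 1) := by
  constructor <;> push_cast <;> linarith [hξ.1, hξ.2]

theorem sub_mem_cell {ε : ℝ} {σ k : ℤ} {ξ : ℝ} (hξ : ξ ∈ cell ε σ k) : ξ - ε ∈ cell ε σ (k - 1) := by
  constructor <;> push_cast <;> linarith [hξ.1, hξ.2]

section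

variable {ε : ℝ} (hε : 0 < ε) {σ : ℤ}
include hε

theorem mem_cell_iff {k : ℤ} {ξ : ℝ} : ξ ∈ cell ε σ k ↔
    (k : ℝ) < ξ / ε - σ / 2 + 1 / 2 ∧ ξ / ε - σ / 2 + 1 / 2 < k + 1 := by
  rw [cell, mem_Ioo, ← lt_div_iff₀' hε, ← div_lt_iff₀' hε]
  constructor <;> rintro ⟨h1, h2⟩ <;> constructor <;> linarith

theorem floor_of_mem_cell {k : ℤ} {ξ : ℝ} (hξ : ξ ∈ cell ε σ k) :
    ⌊ξ / ε - σ / 2 + 1 / 2⌋ = k :=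
  Int.floor_eq_iff.2 ⟨((mem_cell_iff hε).1 hξ).1.le, ((mem_cell_iff hε).1 hξ).2⟩

theorem ceil_of_mem_cell {k : ℤ} {ξ : ℝ} (hξ : ξ ∈ cell ε σ k) :
    ⌈ξ / ε - σ / 2 - 1 / 2⌉ = k :=
  Int.ceil_eq_iff.2 ⟨by linarith [((mem_cell_iff hε).1 hξ).1],
    by linarith [((mem_cell_iff hε).1 hξ).2]⟩

theorem ofLattice_of_mem_cell (a : ℤ → ℝ) {k : ℤ} {ξ : ℝ} (hξ : ξ ∈ cell ε σ k) :
    ofLattice ε σ a ξ = a k := by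
  rw [ofLattice, floor_of_mem_cell hε hξ, ceil_of_mem_cell hε hξ]; ring

theorem center_mem_cell (k : ℤ) : ε * (σ / 2 + k) ∈ cell ε σ k := by
  constructor <;> refine mul_lt_mul_of_pos_left ?_ hε <;> linarith

theorem ae_mem_cell (σ : ℤ) : ∀ᵐ ξ : ℝ, ∃ k, ξ ∈ cell ε σ k := by
  have hc : (range fun k : ℤ => ε * (σ / 2 + k - 1 / 2)).Countable := countable_range _
  filter_upwards [hc.ae_notMem volume] with ξ hξ
  refine ⟨⌊ξ / ε - σ / 2 + 1 / 2⌋, (mem_cell_iff hε).2 ⟨lt_of_le_of_ne (Int.floor_le _) ?_,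
    Int.lt_floor_add_one _⟩⟩
  intro heq
  refine hξ ⟨⌊ξ / ε - σ / 2 + 1 / 2⌋, ?_⟩
  simp only [heq]
  field_simp
  ring

theorem lintegral_eq_tsum_cell {f : ℝ → ℝ≥0∞} {c : ℤ → ℝ≥0∞}
    (hf : ∀ k, ∀ ξ ∈ cell ε σ k, f ξ = c k) : ∫⁻ ξ, f ξ = ENNReal.ofReal ε * ∑' k, c k := by
  have hmeas : ∀ k, MeasurableSet (cell ε σ k) := fun k => measurableSet_Ioo
  have hdisj : Pairwise (Function.onFun Disjoint (cell ε σ)) := by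
    intro k m hkm
    refine Set.disjoint_left.2 fun ξ hk hm => hkm ?_
    rw [← floor_of_mem_cell hε hk, floor_of_mem_cell hε hm]
  have hae : ∀ᵐ ξ : ℝ, ξ ∈ ⋃ k, cell ε σ k := by
    filter_upwards [ae_mem_cell hε σ] with ξ hξ
    exact mem_iUnion.2 hξ
  rw [← Measure.restrict_eq_self_of_ae_mem hae, lintegral_iUnion hmeas hdisj, ← ENNReal.tsum_mul_left]
  refine tsum_congr fun k => ?_
  rw [setLIntegral_congr_fun (hmeas k) (hf k), setLIntegral_const, cell, Real.volume_Ioo, mul_comm]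
  congr 2
  ring

theorem eq_sample_of_mem_cell {v : ℝ → ℝ} (hv : v ∈ Mdisc (latticeSet σ) ε) {k : ℤ} {ξ : ℝ}
    (hξ : ξ ∈ cell ε σ k) : v ξ = sample ε σ v k := by
  have h1 := hv.2 (σ / 2 + k) ⟨k, rfl⟩ (ξ / ε - (σ / 2 + k)) (by
    have := (mem_cell_iff hε).1 hξ
    constructor <;> linarith)
  rw [sample, h1]
  congr 1
  field_simp
  ring

theorem sample_mem_latticeM {v : ℝ → ℝ} (hv : v ∈ M) : sample ε σ v ∈ latticeM σ := by
  refine ⟨fun k m hkm => monotone_of_mem_M hv ?_, fun k => ?_, fun k => (mem_Icc_of_mem_M hv _).2⟩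
  · have : (k : ℝ) ≤ m := by exact_mod_cast hkm
    gcongr
  · rw [sample, sample, ← map_neg_of_mem_M hv]
    congr 1
    push_cast
    ring

theorem sample_ofLattice (a : ℤ → ℝ) : sample ε σ (ofLattice ε σ a) = a :=
  funext fun k => ofLattice_of_mem_cell hε a (center_mem_cell hε k)

/-- Membership in `M` demands oddness at every point, including cell boundaries. Reflection
exchanges the floor and the ceiling, and so preserves their mean up to sign. -/
theorem ofLattice_mem_Mdisc {a : ℤ → ℝ} (ha : a ∈ latticeM σ) :
    ofLattice ε σ a ∈ Mdisc (latticeSet σ) ε := by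
  refine ⟨mem_M (fun x y hxy => ?_) (fun x => ?_) (fun x => ?_), ?_⟩
  · have h1 : x / ε ≤ y / ε := div_le_div_of_nonneg_right hxy hε.le
    have h2 : a ⌊x / ε - σ / 2 + 1 / 2⌋ ≤ a ⌊y / ε - σ / 2 + 1 / 2⌋ :=
      ha.1 (Int.floor_le_floor (by linarith))
    have h3 : a ⌈x / ε - σ / 2 - 1 / 2⌉ ≤ a ⌈y / ε - σ / 2 - 1 / 2⌉ :=
      ha.1 (Int.ceil_le_ceil (by linarith))
    unfold ofLattice
    linarith
  · have h1 : ⌊-x / ε - σ / 2 + 1 / 2⌋ = -σ - ⌈x / ε - σ / 2 - 1 / 2⌉ := by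
      rw [show -x / ε - σ / 2 + 1 / 2 = -(x / ε - σ / 2 - 1 / 2) - (σ : ℤ) by ring,
        Int.floor_sub_intCast, Int.floor_neg]
      ring
    have h2 : ⌈-x / ε - σ / 2 - 1 / 2⌉ = -σ - ⌊x / ε - σ / 2 + 1 / 2⌋ := by
      rw [show -x / ε - σ / 2 - 1 / 2 = -(x / ε - σ / 2 + 1 / 2) - (σ : ℤ) by ring,
        Int.ceil_sub_intCast, Int.ceil_neg]
      ring
    rw [ofLattice, h1, h2, ha.2.1, ha.2.1, ofLattice]
    ring
  · unfold ofLattice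
    linarith [ha.2.2 ⌊x / ε - σ / 2 + 1 / 2⌋, ha.2.2 ⌈x / ε - σ / 2 - 1 / 2⌉]
  · rintro _ ⟨k, rfl⟩ ξ hξ
    rw [ofLattice_of_mem_cell hε a (center_mem_cell hε k),
      ofLattice_of_mem_cell hε a (k := k)]
    rw [← mul_add]
    constructor <;> gcongr <;> linarith [hξ.1, hξ.2]

theorem energy_eq {Ψ : ℝ → ℝ} (h : IsPotential Ψ) {β : ℝ} (hβ : 0 < β) {v : ℝ → ℝ}
    (hv : v ∈ Mdisc (latticeSet σ) ε) :
    energy Ψ β ε v = ENNReal.ofReal ε * latticeEnergy Ψ (β / ε ^ 2) (sample ε σ v) := by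
  set a := sample ε σ v with ha
  have hval : ∀ k, ∀ ξ ∈ cell ε σ k, v ξ = a k := fun k ξ hξ => eq_sample_of_mem_cell hε hv hξ
  have h1 : ∫⁻ ξ, ENNReal.ofReal (F Ψ (v ξ)) =
      ENNReal.ofReal ε * ∑' k, ENNReal.ofReal (F Ψ (a k)) :=
    lintegral_eq_tsum_cell hε (σ := σ) fun k ξ hξ => by rw [hval k ξ hξ]
  have h2 : ∫⁻ ξ, ENNReal.ofReal (((v (ξ + ε) - v ξ) / ε) ^ 2) =
      ENNReal.ofReal ε * ∑' k, ENNReal.ofReal (((a (k + 1) - a k) / ε) ^ 2) :=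
    lintegral_eq_tsum_cell hε (σ := σ) fun k ξ hξ => by
      rw [hval k ξ hξ, hval _ _ (add_mem_cell hξ)]
  rw [energy, h1, h2, mul_left_comm, ← mul_add, ← ENNReal.tsum_mul_left, ← ENNReal.tsum_add,
    latticeEnergy]
  congr 1
  refine tsum_congr fun k => ?_
  rw [← ENNReal.ofReal_mul hβ.le, ← ENNReal.ofReal_add
    (F_nonneg h (mem_Icc_of_mem_latticeM (sample_mem_latticeM hε hv.1) k)) (by positivity)]
  congr 2
  ring

theorem isLatticeMinimizer_sample {Ψ : ℝ → ℝ} (h : IsPotential Ψ) {β : ℝ} (hβ : 0 < β)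
    {v : ℝ → ℝ} (hv : IsMinimizer Ψ β (latticeSet σ) ε v) :
    IsLatticeMinimizer Ψ (β / ε ^ 2) σ (sample ε σ v) := by
  refine ⟨sample_mem_latticeM hε hv.1.1, fun b hb => ?_⟩
  have h1 := hv.2 _ (ofLattice_mem_Mdisc hε hb)
  rw [energy_eq hε h hβ hv.1, energy_eq hε h hβ (ofLattice_mem_Mdisc hε hb),
    sample_ofLattice hε] at h1
  exact (ENNReal.mul_le_mul_iff_right (ENNReal.ofReal_pos.2 hε).ne' ENNReal.ofReal_ne_top).1 h1

theorem exists_isMinimizer {Ψ : ℝ → ℝ} (h : IsPotential Ψ) {β : ℝ} (hβ : 0 < β) :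
    ∃ v, IsMinimizer Ψ β (latticeSet σ) ε v := by
  obtain ⟨a, ha⟩ := h.exists_isLatticeMinimizer (β / ε ^ 2) σ
  refine ⟨ofLattice ε σ a, ofLattice_mem_Mdisc hε ha.1, fun v hv => ?_⟩
  rw [energy_eq hε h hβ (ofLattice_mem_Mdisc hε ha.1), energy_eq hε h hβ hv, sample_ofLattice hε]
  gcongr
  exact ha.2 _ (sample_mem_latticeM hε hv.1)

/-! ### Energy bound and weak equation for minimizers -/

/-- The energy of the truncated linear profile is bounded. -/
theorem exists_latticeEnergy_le (hσ : σ = 0 ∨ σ = 1) {Ψ : ℝ → ℝ} (h : IsPotential Ψ) {β B : ℝ}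
    (hβ : 0 < β) (hB0 : 0 ≤ B) (hB : ∀ x ∈ Icc (-1 : ℝ) 1, F Ψ x ≤ B) :
    ∃ b ∈ latticeM σ, ENNReal.ofReal ε * latticeEnergy Ψ (β / ε ^ 2) b ≤
      ENNReal.ofReal ((2 + 7 * ε) * (B + β)) := by
  have hσ0 : (0 : ℝ) ≤ σ := by rcases hσ with rfl | rfl <;> norm_num
  have hσ1 : (σ : ℝ) ≤ 1 := by rcases hσ with rfl | rfl <;> norm_num
  set b : ℤ → ℝ := fun k => clamp (ε * (σ / 2 + k)) with hb
  have hbM : b ∈ latticeM σ := by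
    refine ⟨fun k m hkm => monotone_clamp ?_, fun k => ?_, fun k => (clamp_mem _).2⟩
    · have : (k : ℝ) ≤ m := by exact_mod_cast hkm
      gcongr
    · simp only [hb, ← clamp_neg]
      congr 1; push_cast; ring
  refine ⟨b, hbM, ?_⟩
  -- The surplus `2` absorbs the offset `σ / 2` and the shift `k + 1`, so the density vanishes for
  -- `|k| > N`. The remaining `2N + 1 ≤ 2/ε + 7` terms give the factor `2 + 7ε`.
  set N : ℤ := ⌈1 / ε⌉ + 2 with hN
  have hN1 : 1 / ε + 2 ≤ N := by
    have := Int.le_ceil (1 / ε)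
    rw [hN]; push_cast; linarith
  have hN2 : (N : ℝ) ≤ 1 / ε + 3 := by
    have := (Int.ceil_lt_add_one (1 / ε)).le
    rw [hN]; push_cast; linarith
  have hε1 : ε * (1 / ε) = 1 := by field_simp
  have hN0 : 0 ≤ N := by
    have h1 : 0 < 1 / ε := by positivity
    have : (0 : ℝ) ≤ N := by linarith
    exact_mod_cast this
  have hone : ∀ k : ℤ, N ≤ k → b k = 1 := by
    intro k hk
    have hk' : (N : ℝ) ≤ k := by exact_mod_cast hk
    refine clamp_of_one_le (hε1.ge.trans ?_)
    gcongr; linarith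
  have hneg : ∀ k : ℤ, k ≤ -N + 1 → b k = -1 := by
    intro k hk
    have hk' : (k : ℝ) ≤ -N + 1 := by exact_mod_cast hk
    refine clamp_of_le_neg_one ?_
    have : ε * (σ / 2 + k) ≤ ε * -(1 / ε) := by gcongr; linarith
    linarith
  have hterm : ∀ k, F Ψ (b k) + β / ε ^ 2 * (b (k + 1) - b k) ^ 2 ≤ B + β := by
    intro k
    have h1 : |b (k + 1) - b k| ≤ ε := by
      refine (abs_clamp_sub_le _ _).trans_eq ?_
      rw [← abs_of_pos hε]; congr 1; push_cast; rw [abs_of_pos hε]; ring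
    have h2 : (b (k + 1) - b k) ^ 2 ≤ ε ^ 2 := sq_le_sq' (by linarith [(abs_le.1 h1).1])
      (abs_le.1 h1).2
    have h3 : β / ε ^ 2 * (b (k + 1) - b k) ^ 2 ≤ β / ε ^ 2 * ε ^ 2 := by gcongr
    rw [div_mul_cancel₀ _ (by positivity)] at h3
    linarith [hB (b k) (clamp_mem _)]
  have hzero : ∀ k ∉ Finset.Icc (-N) N,
      ENNReal.ofReal (F Ψ (b k) + β / ε ^ 2 * (b (k + 1) - b k) ^ 2) = 0 := by
    intro k hk
    rw [Finset.mem_Icc, not_and_or, not_le, not_le] at hk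
    rcases hk with hk | hk
    · rw [hneg k (by omega), hneg (k + 1) (by omega), h.F_neg_one]; simp
    · rw [hone k (by omega), hone (k + 1) (by omega), h.F_one]; simp
  have hcard : ((Finset.Icc (-N) N).card : ℝ) = 2 * N + 1 := by
    rw [Int.card_Icc]
    have : ((N + 1 - -N).toNat : ℤ) = 2 * N + 1 := by omega
    exact_mod_cast this
  rw [latticeEnergy, tsum_eq_sum hzero]
  calc _ ≤ ENNReal.ofReal ε * ∑ k ∈ Finset.Icc (-N) N, ENNReal.ofReal (B + β) := by
        exact mul_le_mul_right (Finset.sum_le_sum fun k _ => ENNReal.ofReal_le_ofReal (hterm k)) _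
    _ = ENNReal.ofReal (ε * (2 * N + 1) * (B + β)) := by
        rw [Finset.sum_const, nsmul_eq_mul, ← mul_assoc, ← ENNReal.ofReal_natCast, hcard,
          ← ENNReal.ofReal_mul hε.le, ← ENNReal.ofReal_mul (mul_nonneg hε.le (by rw [← hcard]; positivity))]
    _ ≤ _ := by
        refine ENNReal.ofReal_le_ofReal (mul_le_mul_of_nonneg_right ?_ (by positivity))
        have : ε * N ≤ ε * (1 / ε + 3) := by gcongr
        linarith

theorem energy_le_of_isMinimizer (hσ : σ = 0 ∨ σ = 1) {Ψ : ℝ → ℝ} (h : IsPotential Ψ) {β B : ℝ}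
    (hβ : 0 < β) (hB0 : 0 ≤ B) (hB : ∀ x ∈ Icc (-1 : ℝ) 1, F Ψ x ≤ B) {v : ℝ → ℝ}
    (hv : IsMinimizer Ψ β (latticeSet σ) ε v) :
    energy Ψ β ε v ≤ ENNReal.ofReal ((2 + 7 * ε) * (B + β)) := by
  obtain ⟨b, hb, hle⟩ := exists_latticeEnergy_le hε hσ h hβ hB0 hB
  refine (hv.2 _ (ofLattice_mem_Mdisc hε hb)).trans ?_
  rwa [energy_eq hε h hβ (ofLattice_mem_Mdisc hε hb), sample_ofLattice hε]

theorem latticeEnergy_ne_top_of_isMinimizer (hσ : σ = 0 ∨ σ = 1) {Ψ : ℝ → ℝ} (h : IsPotential Ψ)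
    {β : ℝ} (hβ : 0 < β) {v : ℝ → ℝ} (hv : IsMinimizer Ψ β (latticeSet σ) ε v) :
    latticeEnergy Ψ (β / ε ^ 2) (sample ε σ v) ≠ ⊤ := by
  obtain ⟨B, hB0, hB⟩ := h.exists_bound_F
  have h1 := energy_le_of_isMinimizer hε hσ h hβ hB0 hB hv
  rw [energy_eq hε h hβ hv.1] at h1
  intro htop
  rw [htop, ENNReal.mul_top (ENNReal.ofReal_pos.2 hε).ne'] at h1
  exact ENNReal.ofReal_ne_top (top_le_iff.1 h1)

theorem ae_discrete_equation (hσ : σ = 0 ∨ σ = 1) {Ψ : ℝ → ℝ} (h : IsPotential Ψ)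
    {β : ℝ} (hβ : 0 < β) {v : ℝ → ℝ} (hv : IsMinimizer Ψ β (latticeSet σ) ε v) :
    ∀ᵐ ξ : ℝ, F' Ψ (v ξ) = 2 * (β / ε ^ 2) * (v (ξ + ε) + v (ξ - ε) - 2 * v ξ) := by
  filter_upwards [ae_mem_cell hε σ] with ξ ⟨k, hk⟩
  rw [eq_sample_of_mem_cell hε hv.1 hk, eq_sample_of_mem_cell hε hv.1 (add_mem_cell hk),
    eq_sample_of_mem_cell hε hv.1 (sub_mem_cell hk)]
  exact h.euler_lagrange (div_pos hβ (by positivity)) (isLatticeMinimizer_sample hε h hβ hv)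
    (latticeEnergy_ne_top_of_isMinimizer hε hσ h hβ hv) k

theorem isWeakDiscreteSolution (hσ : σ = 0 ∨ σ = 1) {Ψ : ℝ → ℝ} (h : IsPotential Ψ)
    {β : ℝ} (hβ : 0 < β) {v : ℝ → ℝ} (hv : IsMinimizer Ψ β (latticeSet σ) ε v) :
    IsWeakDiscreteSolution Ψ β ε v := by
  intro φ hφ hφc
  have hφi : Integrable φ := hφ.continuous.integrable_of_hasCompactSupport hφc
  have hmeas : Measurable v := (monotone_of_mem_M hv.1.1).measurable
  have hbd : ∀ x, ‖v x‖ ≤ 1 := fun x => abs_le.2 (mem_Icc_of_mem_M hv.1.1 x)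
  have hint : ∀ s t : ℝ, Integrable fun ξ => v (ξ + s) * φ (ξ + t) := fun s t =>
    (hφi.comp_add_right t).bdd_mul (c := 1)
      (hmeas.comp (measurable_add_const s)).aestronglyMeasurable (Eventually.of_forall fun x => hbd _)
  -- Translation invariance moves the second difference from `v` to `φ`.
  have hshift : ∀ s : ℝ, ∫ ξ, v (ξ + s) * φ ξ = ∫ ξ, v ξ * φ (ξ - s) := fun s => by
    rw [← integral_add_right_eq_self (fun ξ => v ξ * φ (ξ - s)) s]
    simp
  have e1 := hint ε 0
  have e2 := hint (-ε) 0
  have e3 := hint 0 0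
  have e4 := hint 0 ε
  have e5 := hint 0 (-ε)
  simp only [add_zero, ← sub_eq_add_neg] at e1 e2 e3 e4 e5
  have hlhs : ∫ ξ, F' Ψ (v ξ) * φ ξ = ∫ ξ, 2 * (β / ε ^ 2) *
      (v (ξ + ε) * φ ξ + v (ξ - ε) * φ ξ - 2 * (v ξ * φ ξ)) := by
    refine integral_congr_ae ?_
    filter_upwards [ae_discrete_equation hε hσ h hβ hv] with ξ hξ
    rw [hξ]; ring
  have hrhs : ∫ ξ, v ξ * ((φ (ξ + ε) + φ (ξ - ε) - 2 * φ ξ) / ε ^ 2) =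
      ∫ ξ, 1 / ε ^ 2 * (v ξ * φ (ξ + ε) + v ξ * φ (ξ - ε) - 2 * (v ξ * φ ξ)) := by
    congr 1
    funext ξ
    ring
  have s1 := hshift ε
  have s2 := hshift (-ε)
  simp only [sub_neg_eq_add, ← sub_eq_add_neg] at s2
  have e12 : Integrable fun ξ => v (ξ + ε) * φ ξ + v (ξ - ε) * φ ξ := e1.add e2
  have e45 : Integrable fun ξ => v ξ * φ (ξ + ε) + v ξ * φ (ξ - ε) := e4.add e5
  rw [hlhs, hrhs, integral_const_mul, integral_const_mul, integral_sub e12 (e3.const_mul 2),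
    integral_sub e45 (e3.const_mul 2), integral_add e1 e2, integral_add e4 e5, s1, s2]
  ring

end

/-! ### Perturbed Euler scheme and discrete first integral -/

/-- Since `|x - y| ≤ x + y`, one has `(x - y)² ≤ |x² - y²|`. This passes from squared slopes to
slopes without dividing by the speed, which degenerates at `±1`. -/
theorem abs_sub_le_sqrt {x y z : ℝ} (hx : 0 ≤ x) (hy : 0 ≤ y) (hz : |x ^ 2 - y ^ 2| ≤ z) :
    |x - y| ≤ √z := by
  refine Real.abs_le_sqrt ?_
  have h1 := abs_le.1 hz
  rcases le_total x y with h | h <;> nlinarith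

/-- One step of the explicit Euler scheme approximates an integral curve to second order. -/
theorem euler_step {g u : ℝ → ℝ} {K G : NNReal} (hg : LipschitzWith K g) (hG : ∀ x, |g x| ≤ G)
    (hu : ∀ t, HasDerivAt u (g (u t)) t) (x : ℝ) {ε : ℝ} (hε : 0 ≤ ε) :
    |u (x + ε) - u x - ε * g (u x)| ≤ K * G * ε * ε := by
  have hlip : ∀ s t, |u s - u t| ≤ G * |s - t| := fun s t =>
    convex_univ.norm_image_sub_le_of_norm_hasDerivWithin_le (f := u)
      (fun r _ => (hu r).hasDerivWithinAt) (fun t _ => hG (u t)) (mem_univ t) (mem_univ s)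
  have h1 := (convex_Icc x (x + ε)).norm_image_sub_le_of_norm_hasDerivWithin_le
    (f := fun s => u s - g (u x) * s) (f' := fun s => g (u s) - g (u x)) (C := K * G * ε)
    (fun s _ => by
      have := (hu s).sub ((hasDerivAt_id s).const_mul (g (u x)))
      rw [mul_one] at this
      exact this.hasDerivWithinAt)
    (fun s hs => by
      refine (hg.dist_le_mul (u s) (u x)).trans ?_
      rw [Real.dist_eq, mul_assoc]
      refine mul_le_mul_of_nonneg_left ((hlip s x).trans ?_) K.2
      rw [abs_of_nonneg (by linarith [hs.1])]
      exact mul_le_mul_of_nonneg_left (by linarith [hs.2]) G.2)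
    (left_mem_Icc.2 (by linarith)) (right_mem_Icc.2 (by linarith))
  rw [Real.norm_eq_abs, Real.norm_eq_abs, add_sub_cancel_left, abs_of_nonneg hε] at h1
  refine le_of_eq_of_le ?_ h1
  congr 1; ring

/-- Convergence of a perturbed explicit Euler scheme. -/
theorem euler_scheme_error {g u : ℝ → ℝ} {K G : NNReal} (hg : LipschitzWith K g)
    (hG : ∀ x, |g x| ≤ G) (hu : ∀ t, HasDerivAt u (g (u t)) t) {a : ℤ → ℝ} {ε δ x₀ : ℝ}
    (hε : 0 < ε) (ha : ∀ k, |(a (k + 1) - a k) / ε - g (a k)| ≤ δ) (n : ℕ) :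
    |a n - u (x₀ + ε * n)| ≤
      (|a 0 - u x₀| + n * ε * (δ + K * G * ε)) * Real.exp (n * ε * K) := by
  have hδ : 0 ≤ δ := (abs_nonneg _).trans (ha 0)
  -- The errors satisfy `e_{m+1} ≤ (1 + εK) e_m + ε(δ + KGε)`: Lipschitz growth, defect of the
  -- scheme, and consistency error of one Euler step.
  have h1 := discrete_gronwall (u := fun n : ℕ => |a n - u (x₀ + ε * n)|) (n₀ := 0)
    (c := fun _ => ε * K) (b := fun _ => ε * (δ + K * G * ε)) (abs_nonneg _)
    (fun m _ => by
      have e1 := ha m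
      have e2 := euler_step hg hG hu (x₀ + ε * m) hε.le
      have e3 := hg.dist_le_mul (a m) (u (x₀ + ε * m))
      rw [Real.dist_eq, Real.dist_eq] at e3
      have e4 : |a (m + 1) - a m - ε * g (a m)| ≤ ε * δ := by
        have : a (m + 1) - a m - ε * g (a m) = ε * ((a (m + 1) - a m) / ε - g (a m)) := by
          field_simp
        rw [this, abs_mul, abs_of_pos hε]
        exact mul_le_mul_of_nonneg_left e1 hε.le
      have e5 : |ε * (g (a m) - g (u (x₀ + ε * m)))| ≤ ε * (K * |a m - u (x₀ + ε * m)|) := by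
        rw [abs_mul, abs_of_pos hε]
        exact mul_le_mul_of_nonneg_left e3 hε.le
      have e6 : x₀ + ε * ((m + 1 : ℕ) : ℝ) = x₀ + ε * m + ε := by push_cast; ring
      simp only [e6]
      push_cast
      rw [show a (m + 1) - u (x₀ + ε * m + ε) = (a m - u (x₀ + ε * m)) +
        (a (m + 1) - a m - ε * g (a m)) + ε * (g (a m) - g (u (x₀ + ε * m))) -
        (u (x₀ + ε * m + ε) - u (x₀ + ε * m) - ε * g (u (x₀ + ε * m))) by ring]
      refine (abs_sub _ _).trans ?_
      refine (add_le_add_left ((abs_add_le _ _).trans (add_le_add_left (abs_add_le _ _) _)) _).trans ?_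
      linarith)
    (fun _ _ => by positivity) (fun _ _ => by positivity) (Nat.zero_le n)
  simp only [Finset.sum_const, Nat.Ico_zero_eq_range, Finset.card_range, nsmul_eq_mul,
    Nat.cast_zero, mul_zero, add_zero] at h1
  refine h1.trans_eq ?_
  rw [mul_assoc (n : ℝ) ε, mul_assoc (n : ℝ) ε]

namespace IsPotential

variable {Ψ : ℝ → ℝ} (h : IsPotential Ψ) {β ε : ℝ} (hβ : 0 < β) (hε : 0 < ε) {σ : ℤ} {a : ℤ → ℝ}
include h hβ hε

/-- The gradient part of the energy is `ε · β/ε²` times the sum, so bounded energy makes the sum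
`O(ε)`. -/
theorem tsum_sq_diff_le (ha : a ∈ latticeM σ) {C : ℝ} (hC : 0 ≤ C)
    (hE : ENNReal.ofReal ε * latticeEnergy Ψ (β / ε ^ 2) a ≤ ENNReal.ofReal C) :
    ∑' k, (a (k + 1) - a k) ^ 2 ≤ C * ε / β := by
  have hκ : 0 < β / ε ^ 2 := by positivity
  have hfin : latticeEnergy Ψ (β / ε ^ 2) a ≠ ⊤ := by
    intro htop
    rw [htop, ENNReal.mul_top (ENNReal.ofReal_pos.2 hε).ne'] at hE
    exact ENNReal.ofReal_ne_top (top_le_iff.1 hE)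
  have hs := h.summable_density hκ ha hfin
  have hs2 := h.summable_sq_diff hκ ha hfin
  rw [h.latticeEnergy_eq hκ ha hs, ← ENNReal.ofReal_mul hε.le,
    ENNReal.ofReal_le_ofReal_iff hC] at hE
  have h1 : β / ε ^ 2 * ∑' k, (a (k + 1) - a k) ^ 2 ≤
      ∑' k, (F Ψ (a k) + β / ε ^ 2 * (a (k + 1) - a k) ^ 2) := by
    rw [← tsum_mul_left]
    exact (hs2.mul_left _).tsum_le_tsum (fun k => by
      linarith [F_nonneg h (mem_Icc_of_mem_latticeM ha k)]) hs
  have h2 := (mul_le_mul_of_nonneg_left h1 hε.le).trans hE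
  rw [le_div_iff₀ hβ]
  have h3 : ε * (β / ε ^ 2 * ∑' k, (a (k + 1) - a k) ^ 2) =
      (∑' k, (a (k + 1) - a k) ^ 2) * β / ε := by field_simp
  rw [h3, div_le_iff₀ hε] at h2
  exact h2

/-- The discrete first integral is small. -/
theorem abs_first_integral_le {L : ℝ}
    (hL : ∀ x ∈ Icc (-1 : ℝ) 1, ∀ y ∈ Icc (-1 : ℝ) 1,
      |F Ψ y - F Ψ x - F' Ψ x * (y - x)| ≤ L * (y - x) ^ 2) (hL0 : 0 ≤ L)
    (ha : IsLatticeMinimizer Ψ (β / ε ^ 2) σ a)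
    (hfin : latticeEnergy Ψ (β / ε ^ 2) a ≠ ⊤) (k : ℤ) :
    |β * ((a (k + 1) - a k) / ε) ^ 2 - (F Ψ (a k) + F Ψ (a (k + 1))) / 2| ≤
      L * ∑' k, (a (k + 1) - a k) ^ 2 := by
  have hκ : 0 < β / ε ^ 2 := by positivity
  have hmem := mem_Icc_of_mem_latticeM ha.1
  have hs := h.summable_sq_diff hκ ha.1 hfin
  have hsF := h.summable_F hκ ha.1 hfin
  set D : ℤ → ℝ := fun k => (a (k + 1) - a k) ^ 2 with hD
  set R : ℤ → ℝ := fun k =>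
    β * ((a (k + 1) - a k) / ε) ^ 2 - (F Ψ (a k) + F Ψ (a (k + 1))) / 2 with hR
  have hstep : ∀ k, |R (k + 1) - R k| ≤ L / 2 * (D (k + 1) + D k) := by
    intro k
    have e := h.euler_lagrange hκ ha hfin (k + 1)
    rw [add_sub_cancel_right] at e
    -- The difference of squares factors as second difference times `a_{k+2} - a_k`; by the discrete
    -- equation it equals `F'(a_{k+1})(a_{k+2} - a_k)/2`. This cancels the linear part of the change
    -- of `F`, leaving two Taylor remainders at `a_{k+1}`.
    have e1 : R (k + 1) - R k =
        ((F Ψ (a k) - F Ψ (a (k + 1)) - F' Ψ (a (k + 1)) * (a k - a (k + 1))) -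
        (F Ψ (a (k + 1 + 1)) - F Ψ (a (k + 1)) -
          F' Ψ (a (k + 1)) * (a (k + 1 + 1) - a (k + 1)))) / 2 := by
      rw [e]; simp only [hR]; field_simp; ring
    have e2 := hL (a (k + 1)) (hmem _) (a k) (hmem _)
    have e3 := hL (a (k + 1)) (hmem _) (a (k + 1 + 1)) (hmem _)
    rw [e1, abs_div, abs_two, div_le_iff₀ two_pos]
    refine (abs_sub _ _).trans ((add_le_add e2 e3).trans_eq ?_)
    simp only [hD]; ring
  have hinj : ∀ k : ℤ, Function.Injective fun n : ℕ => k + (n : ℤ) := fun k m n hmn => by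
    simpa using hmn
  have hsk : ∀ k : ℤ, Summable fun n : ℕ => D (k + n) := fun k => hs.comp_injective (hinj k)
  have hle : ∀ k : ℤ, ∑' n : ℕ, D (k + n) ≤ ∑' k, D k := fun k =>
    (hsk k).tsum_le_tsum_of_inj (fun n : ℕ => k + (n : ℤ)) (hinj k) (fun _ _ => sq_nonneg _)
      (fun _ => le_rfl) hs
  have hlim : Tendsto (fun n : ℕ => R (k + n)) atTop (𝓝 0) := by
    have t1 := (hsk k).tendsto_atTop_zero
    have t2 := (hsF.comp_injective (hinj k)).tendsto_atTop_zero
    have t3 := (hsF.comp_injective (hinj (k + 1))).tendsto_atTop_zero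
    have t4 := (t1.const_mul (β / ε ^ 2)).sub ((t2.add t3).div_const 2)
    simp only [mul_zero, add_zero, zero_div, sub_zero] at t4
    refine t4.congr fun n => ?_
    simp only [hR, hD, Function.comp, div_pow]
    rw [show k + 1 + (n : ℤ) = k + n + 1 by ring]
    ring
  have hsd : Summable fun n : ℕ => L / 2 * (D (k + 1 + n) + D (k + n)) :=
    ((hsk (k + 1)).add (hsk k)).mul_left _
  -- Telescoping starts at `+∞`, where `R` vanishes, so no boundary term appears.
  have hfinal := dist_le_tsum_of_dist_le_of_tendsto₀ (f := fun n : ℕ => R (k + n))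
    (fun n : ℕ => L / 2 * (D (k + 1 + n) + D (k + n))) (fun n => by
      have := hstep (k + n)
      rw [Real.dist_eq, abs_sub_comm]
      rw [show k + 1 + (n : ℤ) = k + n + 1 by ring, Nat.succ_eq_add_one, Nat.cast_add_one,
        ← add_assoc]
      exact this) hsd hlim
  simp only [Nat.cast_zero, add_zero, Real.dist_eq, sub_zero] at hfinal
  refine hfinal.trans ?_
  rw [tsum_mul_left, (hsk (k + 1)).tsum_add (hsk k)]
  have := mul_le_mul_of_nonneg_left (add_le_add (hle (k + 1)) (hle k)) (div_nonneg hL0 zero_le_two)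
  linarith

theorem abs_diff_le {s : ℝ} (hs : ∑' k, (a (k + 1) - a k) ^ 2 ≤ s)
    (ha : a ∈ latticeM σ) (hfin : latticeEnergy Ψ (β / ε ^ 2) a ≠ ⊤) (k : ℤ) :
    |a (k + 1) - a k| ≤ √s :=
  Real.abs_le_sqrt (((h.summable_sq_diff (by positivity) ha hfin).le_tsum k
    fun _ _ => sq_nonneg _).trans hs)

/-- Lattice minimizers almost solve the explicit Euler scheme for the first order equation. -/
theorem abs_slope_sub_speed_le {L L₁ s : ℝ}
    (hL : ∀ x ∈ Icc (-1 : ℝ) 1, ∀ y ∈ Icc (-1 : ℝ) 1,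
      |F Ψ y - F Ψ x - F' Ψ x * (y - x)| ≤ L * (y - x) ^ 2) (hL0 : 0 ≤ L)
    (hL₁ : ∀ x ∈ Icc (-1 : ℝ) 1, ∀ y ∈ Icc (-1 : ℝ) 1, |F Ψ x - F Ψ y| ≤ L₁ * |x - y|)
    (hL₁0 : 0 ≤ L₁) (hs : ∑' k, (a (k + 1) - a k) ^ 2 ≤ s)
    (ha : IsLatticeMinimizer Ψ (β / ε ^ 2) σ a)
    (hfin : latticeEnergy Ψ (β / ε ^ 2) a ≠ ⊤) (k : ℤ) :
    |(a (k + 1) - a k) / ε - speed Ψ β (a k)| ≤ √(L * s / β + L₁ * √s / (2 * β)) := by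
  have hmem := mem_Icc_of_mem_latticeM ha.1
  refine abs_sub_le_sqrt (div_nonneg (sub_nonneg.2 (ha.1.1 (by omega))) hε.le)
    (speed_nonneg _ _ _) ?_
  rw [h.sq_speed hβ (hmem k)]
  have h1 := (h.abs_first_integral_le hβ hε hL hL0 ha hfin k).trans
    (mul_le_mul_of_nonneg_left hs hL0)
  have h2 := (hL₁ _ (hmem (k + 1)) _ (hmem k)).trans
    (mul_le_mul_of_nonneg_left (h.abs_diff_le hβ hε hs ha.1 hfin k) hL₁0)
  have h3 : ((a (k + 1) - a k) / ε) ^ 2 - F Ψ (a k) / β =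
      (β * ((a (k + 1) - a k) / ε) ^ 2 - (F Ψ (a k) + F Ψ (a (k + 1))) / 2) / β +
        (F Ψ (a (k + 1)) - F Ψ (a k)) / (2 * β) := by
    field_simp; ring
  rw [h3]
  refine (abs_add_le _ _).trans (add_le_add ?_ ?_)
  · rw [abs_div, abs_of_pos hβ]
    exact div_le_div_of_nonneg_right h1 hβ.le
  · rw [abs_div, abs_of_pos (by positivity : 0 < 2 * β)]
    exact div_le_div_of_nonneg_right h2 (by positivity)

end IsPotential

/-! ### Convergence of minimizers to the heteroclinic profile -/

/-- Minimizers converge locally uniformly to the heteroclinic profile, with an explicit rate. -/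
theorem exists_convergence_rate {Ψ : ℝ → ℝ} (h : IsPotential Ψ) {β : ℝ} (hβ : 0 < β) {σ : ℤ}
    (hσ : σ = 0 ∨ σ = 1) {u : ℝ → ℝ} (hu : IsHeteroclinic Ψ β u) {T : ℝ} (hT : 0 ≤ T) :
    ∃ rate : ℝ → ℝ, Tendsto rate (𝓝[>] 0) (𝓝 0) ∧ ∀ ε, 0 < ε → ε ≤ 1 → ∀ v : ℝ → ℝ,
      IsMinimizer Ψ β (latticeSet σ) ε v → ∀ᵐ ξ : ℝ, |ξ| ≤ T → |v ξ - u ξ| ≤ rate ε := by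
  obtain ⟨B, hB0, hB⟩ := h.exists_bound_F
  obtain ⟨L, hL0, hL⟩ := h.exists_taylor_F
  obtain ⟨L₁, hL₁0, hL₁⟩ := h.exists_lipschitz_F
  obtain ⟨K, hK⟩ := h.exists_lipschitz_speed hβ
  obtain ⟨G, hG⟩ := h.exists_bound_speed hβ
  have hd := h.hasDerivAt_of_isHeteroclinic hβ hu
  have hlip : ∀ s t, |u s - u t| ≤ G * |s - t| := fun s t =>
    convex_univ.norm_image_sub_le_of_norm_hasDerivWithin_le (f := u)
      (fun t _ => (hd t).hasDerivWithinAt) (fun t _ => hG (u t)) (mem_univ t) (mem_univ s)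
  -- Bounds the sum of squared differences; `9` is `2 + 7ε` at `ε = 1`. Consequently `δ` is of order
  -- `ε^(1/4)`.
  set s : ℝ → ℝ := fun ε => 9 * (B + β) * ε / β with hs
  set δ : ℝ → ℝ := fun ε => √(L * s ε / β + L₁ * √(s ε) / (2 * β)) with hδ
  set rate : ℝ → ℝ := fun ε => (√(s ε) + G * ε + (T + 1) * (δ ε + K * G * ε)) *
    Real.exp ((T + 1) * K) + G * ε with hrate
  have hrate_lim : Tendsto rate (𝓝[>] 0) (𝓝 0) := by
    have hc : Continuous rate := by simp only [hrate, hδ, hs]; fun_prop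
    have h0 : rate 0 = 0 := by simp [hrate, hδ, hs]
    exact (h0 ▸ hc.tendsto 0).mono_left nhdsWithin_le_nhds
  refine ⟨rate, hrate_lim, fun ε hε hε1 v hv => ?_⟩
  set a := sample ε σ v with ha
  have hmin := isLatticeMinimizer_sample hε h hβ hv
  have hfin := latticeEnergy_ne_top_of_isMinimizer hε hσ h hβ hv
  have hE := energy_le_of_isMinimizer hε hσ h hβ hB0 hB hv
  rw [energy_eq hε h hβ hv.1] at hE
  have hsum : ∑' k, (a (k + 1) - a k) ^ 2 ≤ s ε :=
    h.tsum_sq_diff_le hβ hε hmin.1 (by positivity) (hE.trans (ENNReal.ofReal_le_ofReal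
      (mul_le_mul_of_nonneg_right (by linarith) (by positivity))))
  have hstep := h.abs_slope_sub_speed_le hβ hε hL hL0 hL₁ hL₁0 hsum hmin hfin
  have hσ0 : (0 : ℝ) ≤ σ := by rcases hσ with rfl | rfl <;> norm_num
  have hσ1 : (σ : ℝ) ≤ 1 := by rcases hσ with rfl | rfl <;> norm_num
  -- On-site, `a 0 = 0` by oddness. Inter-site, `a (-1) = -a 0`, so `2 a 0` is a single jump,
  -- bounded by `√(s ε)`.
  have hinit : |a 0 - u (ε * (σ / 2))| ≤ √(s ε) + G * ε := by
    have h1 : |a 0| ≤ √(s ε) := by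
      have h2 := h.abs_diff_le hβ hε hsum hmin.1 hfin (-1)
      have h3 := hmin.1.2.1 0
      rcases hσ with rfl | rfl
      · have : a 0 = 0 := by
          simp only [neg_zero, sub_zero] at h3
          linarith
        rw [this, abs_zero]; exact Real.sqrt_nonneg _
      · norm_num at h2 h3
        rw [← ha] at h3
        rw [h3, sub_neg_eq_add, ← two_mul, abs_mul, abs_two] at h2
        linarith [abs_nonneg (a 0)]
    have h2 : |u (ε * (σ / 2))| ≤ G * ε := by
      have h3 := hlip (ε * (σ / 2)) 0
      rw [map_zero_of_mem_M hu.1, sub_zero, sub_zero,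
        abs_of_nonneg (mul_nonneg hε.le (div_nonneg hσ0 zero_le_two))] at h3
      refine h3.trans (mul_le_mul_of_nonneg_left ?_ G.2)
      nlinarith
    exact (abs_sub _ _).trans (add_le_add h1 h2)
  have hpos : ∀ (n : ℕ) (ξ : ℝ), ξ ∈ cell ε σ n → |ξ| ≤ T → |v ξ - u ξ| ≤ rate ε := by
    intro n ξ hξ hξT
    rw [eq_sample_of_mem_cell hε hv.1 hξ]
    have h1 := euler_scheme_error hK hG hd (x₀ := ε * (σ / 2)) hε hstep n
    have hnT : n * ε ≤ T + 1 := by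
      have h2 := hξ.1
      have h3 := (abs_le.1 hξT).2
      push_cast at h2
      nlinarith
    have h2 : |u (ε * (σ / 2) + ε * n) - u ξ| ≤ G * ε := by
      refine (hlip _ _).trans (mul_le_mul_of_nonneg_left ?_ G.2)
      have := hξ.1
      have := hξ.2
      push_cast at *
      exact abs_le.2 ⟨by nlinarith, by nlinarith⟩
    have h3 : |a n - u (ε * (σ / 2) + ε * n)| ≤ (√(s ε) + G * ε + (T + 1) * (δ ε + K * G * ε)) *
        Real.exp ((T + 1) * K) := by
      have hδ0 : 0 ≤ δ ε := Real.sqrt_nonneg _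
      refine h1.trans ?_
      gcongr
    calc _ ≤ |a n - u (ε * (σ / 2) + ε * n)| + |u (ε * (σ / 2) + ε * n) - u ξ| :=
          abs_sub_le _ _ _
      _ ≤ _ := add_le_add h3 h2
  filter_upwards [ae_mem_cell hε σ] with ξ ⟨k, hk⟩ hξT
  rcases le_or_gt 0 k with hk0 | hk0
  · obtain ⟨n, rfl⟩ := Int.eq_ofNat_of_zero_le hk0
    exact hpos n ξ hk hξT
  -- Negative cells follow by oddness: reflection sends cell `k` to cell `-σ - k`, which is
  -- nonnegative because `k ≤ -1` and `σ ≤ 1`.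
  · obtain ⟨n, hn⟩ := Int.eq_ofNat_of_zero_le (show 0 ≤ -σ - k by omega)
    have hmem : -ξ ∈ cell ε σ n := by
      have hn' : (n : ℝ) = -σ - k := by exact_mod_cast hn.symm
      constructor <;> push_cast <;> rw [hn'] <;> linarith [hk.1, hk.2]
    have h1 := hpos n (-ξ) hmem (by rwa [abs_neg])
    rw [map_neg_of_mem_M hv.1.1, map_neg_of_mem_M hu.1, ← neg_sub', abs_neg] at h1
    exact h1

theorem tendstoLinftyLoc_of_isMinimizer {Ψ : ℝ → ℝ} (h : IsPotential Ψ) {β : ℝ} (hβ : 0 < β)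
    {σ : ℤ} (hσ : σ = 0 ∨ σ = 1) {u : ℝ → ℝ} (hu : IsHeteroclinic Ψ β u) {uε : ℝ → ℝ → ℝ}
    (huε : ∀ ε, 0 < ε → IsMinimizer Ψ β (latticeSet σ) ε (uε ε)) : TendstoLinftyLoc uε u := by
  intro S hS
  obtain ⟨T, hT0, hT⟩ : ∃ T : ℝ, 0 ≤ T ∧ ∀ ξ ∈ S, |ξ| ≤ T := by
    obtain ⟨T, hT⟩ := hS.isBounded.exists_norm_le
    exact ⟨max T 0, le_max_right _ _, fun ξ hξ => (hT ξ hξ).trans (le_max_left _ _)⟩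
  obtain ⟨rate, hrate, hle⟩ := exists_convergence_rate h hβ hσ hu hT0
  have hrate' : Tendsto (fun ε => ENNReal.ofReal (rate ε)) (𝓝[>] 0) (𝓝 0) := by
    simpa using ENNReal.tendsto_ofReal hrate
  refine tendsto_of_tendsto_of_tendsto_of_le_of_le' tendsto_const_nhds hrate'
    (Eventually.of_forall fun _ => zero_le) ?_
  filter_upwards [Ioc_mem_nhdsGT (zero_lt_one' ℝ)] with ε hε
  rw [eLpNorm_exponent_top]
  refine eLpNormEssSup_le_of_ae_bound ?_
  rw [ae_restrict_iff' hS.measurableSet]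
  filter_upwards [hle ε hε.1 hε.2 _ (huε ε hε.1)] with ξ hξ hξS
  exact hξ (hT ξ hξS)

end DNLS

theorem mainTheorem3 (Ψ : ℝ → ℝ) (hΨ : DNLS.IsPotential Ψ) (β : ℝ) (hβ : 0 < β) :
    ∃ u : ℝ → ℝ,
      -- `u` is the unique odd increasing heteroclinic solution of the limit problem
      DNLS.IsHeteroclinic Ψ β u ∧
      (∀ w : ℝ → ℝ, DNLS.IsHeteroclinic Ψ β w → w = u) ∧
      -- both settings
      ∀ Z : Set ℝ, Z = DNLS.onSite ∨ Z = DNLS.interSite →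
        -- minimizers exist and satisfy the discrete standing wave equation
        (∀ ε : ℝ, 0 < ε → ∃ v : ℝ → ℝ, DNLS.IsMinimizer Ψ β Z ε v) ∧
        (∀ ε : ℝ, 0 < ε → ∀ v : ℝ → ℝ, DNLS.IsMinimizer Ψ β Z ε v →
          DNLS.IsWeakDiscreteSolution Ψ β ε v) ∧
        -- uniform energy bound
        (∃ C : ℝ, ∀ ε : ℝ, 0 < ε → ε ≤ 1 → ∀ v : ℝ → ℝ, DNLS.IsMinimizer Ψ β Z ε v →
          DNLS.energy Ψ β ε v ≤ ENNReal.ofReal C) ∧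
        -- convergence of any family of minimizers
        (∀ uε : ℝ → ℝ → ℝ, (∀ ε : ℝ, 0 < ε → DNLS.IsMinimizer Ψ β Z ε (uε ε)) →
          DNLS.TendstoLinftyLoc uε u) := by
  obtain ⟨u, hu⟩ := hΨ.exists_isHeteroclinic hβ
  obtain ⟨B, hB0, hB⟩ := hΨ.exists_bound_F
  refine ⟨u, hu, fun w hw => hΨ.isHeteroclinic_unique hβ hu hw, fun Z hZ => ?_⟩
  obtain ⟨σ, hσ, rfl⟩ : ∃ σ : ℤ, (σ = 0 ∨ σ = 1) ∧ Z = DNLS.latticeSet σ := by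
    rcases hZ with rfl | rfl
    · exact ⟨0, Or.inl rfl, DNLS.onSite_eq⟩
    · exact ⟨1, Or.inr rfl, DNLS.interSite_eq⟩
  refine ⟨fun ε hε => DNLS.exists_isMinimizer hε hΨ hβ,
    fun ε hε v hv => DNLS.isWeakDiscreteSolution hε hσ hΨ hβ hv,
    ⟨9 * (B + β), fun ε hε hε1 v hv => ?_⟩,
    fun uε huε => DNLS.tendstoLinftyLoc_of_isMinimizer hΨ hβ hσ hu huε⟩
  refine (DNLS.energy_le_of_isMinimizer hε hσ hΨ hβ hB0 hB hv).trans (ENNReal.ofReal_le_ofReal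
    (mul_le_mul_of_nonneg_right (by linarith) (by positivity)))
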